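/- Let $p_2,p_3\in L_1[0,\pi]$ be complex-valued functions, and put $$B=\begin{pmatrix}-i&0\\0&i\end{pmatrix},\qquad P(x)=\begin{pmatrix}0&p_2(x)\\p_3(x)&0\end{pmatrix},\qquad \ell_P(\mathbf y)=B\mathbf y'+P\mathbf y,\quad \mathbf y=\begin{pmatrix}y_1\\y_2\end{pmatrix}.$$ Let $\mathcal U=(C,D)=(u_{jk})$ be a complex $2\times4$ matrix composed of the $2\times2$ blocks $C$ and $D$, let $U(\mathbf y)=C\mathbf y(0)+D\mathbf y(\pi)$, and let $J_{ij}$ be the determinant composed of the $i$-th and $j$-th columns of $\mathcal U$. Assume that the boundary conditions are regular: $J_{14}\cdot J_{23}\neq0$. Let $\mathcal L_{P,U}$ be the operator $\mathbf y\mapsto\ell_P(\mathbf y)$ in $\mathbb H=L_2[0,\pi]\oplus L_2[0,\pi]$ whose domain consists of all absolutely continuous $\mathbf y$ on $[0,\pi]$ with $\ell_P(\mathbf y)\in\mathbb H$ and $U(\mathbf y)=0$. An eigenfunction for $\lambda\in\mathbb C$ is a nonzero $\mathbf y$ with $\mathcal L_{P,U}\mathbf y=\lambda\mathbf y$; an associated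 function for $\lambda$ is a $\mathbf y$ in the domain such that $(\mathcal L_{P,U}-\lambda)\mathbf y$ is an eigenfunction or (recursively) an associated function for $\lambda$. Then for every $\alpha\in[1,\infty)$ the eigenfunctions and associated functions of $\mathcal L_{P,U}$ lie in $(L_\alpha[0,\pi])^2$ and their linear span is dense in this space. In particular, every system $\{\mathbf y_n\}_{n\in\mathbb Z}$ of eigenfunctions and associated functions of $\mathcal L_{P,U}$ (a linearly independent system composed of chains of eigenfunctions and associated functions, whose members for each eigenvalue form a basis of the corresponding root subspace) is complete in $(L_\alpha[0,\pi])^2$. -/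

import Mathlib

open MeasureTheory
open scoped ENNReal Matrix

noncomputable section

namespace DiracOp

/-- Lebesgue measure on the segment `[0, π]`. -/
abbrev segMeasure : Measure ℝ := volume.restrict (Set.Icc 0 Real.pi)

/-- The space `(L_α[0,π])²` of pairs of (classes of) functions, with its product topology. -/
abbrev LpPair (α : ℝ≥0∞) : Type := Fin 2 → Lp ℂ α segMeasure

/-- The Hilbert space `H = L₂[0,π] ⊕ L₂[0,π]`. -/
abbrev H : Type := PiLp 2 (fun _ : Fin 2 => Lp ℂ 2 segMeasure)

/-- The matrix `B = diag(-i, i)`. -/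
def matB : Matrix (Fin 2) (Fin 2) ℂ := !![-Complex.I, 0; 0, Complex.I]

/-- The differential expression `ℓ_P(y) = B y' + P y`. -/
def diracExpr (P : ℝ → Matrix (Fin 2) (Fin 2) ℂ) (y : ℝ → Fin 2 → ℂ) (x : ℝ) : Fin 2 → ℂ :=
  matB *ᵥ deriv y x + P x *ᵥ y x

/-- The boundary form `U(y) = C y(0) + D y(π)`, where the `2 × 4` matrix `U` is `(C, D)`. -/
def boundaryForm (U : Matrix (Fin 2) (Fin 4) ℂ) (y : ℝ → Fin 2 → ℂ) : Fin 2 → ℂ :=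
  !![U 0 0, U 0 1; U 1 0, U 1 1] *ᵥ y 0 + !![U 0 2, U 0 3; U 1 2, U 1 3] *ᵥ y Real.pi

/-- The determinant composed of the columns `i` and `j` (numbered from `0`) of `U`. -/
def minorJ (U : Matrix (Fin 2) (Fin 4) ℂ) (i j : Fin 4) : ℂ :=
  !![U 0 i, U 0 j; U 1 i, U 1 j].det

/-- Birkhoff regularity: `J₁₄ · J₂₃ ≠ 0`, with columns numbered from `1` in this formula. -/
def IsRegularBC (U : Matrix (Fin 2) (Fin 4) ℂ) : Prop :=
  minorJ U 0 3 * minorJ U 1 2 ≠ 0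

/-- The off-diagonal potential with entries `p₂`, `p₃`. -/
def offDiag (p₂ p₃ : ℝ → ℂ) (x : ℝ) : Matrix (Fin 2) (Fin 2) ℂ := !![0, p₂ x; p₃ x, 0]

/-- `y` is a representative of `u` that is absolutely continuous on `[0,π]` and satisfies the
boundary conditions, and `ℓ_P(y) = f` almost everywhere. -/
structure IsRep (P : ℝ → Matrix (Fin 2) (Fin 2) ℂ) (U : Matrix (Fin 2) (Fin 4) ℂ)
    (u f : H) (y : ℝ → Fin 2 → ℂ) : Prop where
  ac : AbsolutelyContinuousOnInterval y 0 Real.pi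
  rep : ∀ j, (u j : ℝ → ℂ) =ᵐ[segMeasure] fun x => y x j
  bc : boundaryForm U y = 0
  eqn : ∀ j, (f j : ℝ → ℂ) =ᵐ[segMeasure] fun x => diracExpr P y x j

theorem ae_differentiableAt {y : ℝ → Fin 2 → ℂ}
    (hy : AbsolutelyContinuousOnInterval y 0 Real.pi) :
    ∀ᵐ x ∂segMeasure, DifferentiableAt ℝ y x := by
  have h := hy.boundedVariationOn.ae_differentiableAt_of_mem_uIcc
  rw [Set.uIcc_of_le Real.pi_pos.le] at h
  exact (ae_restrict_iff' measurableSet_Icc).2 h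

theorem IsRep.add {P : ℝ → Matrix (Fin 2) (Fin 2) ℂ} {U : Matrix (Fin 2) (Fin 4) ℂ}
    {u f v g : H} {y z : ℝ → Fin 2 → ℂ} (h : IsRep P U u f y) (k : IsRep P U v g z) :
    IsRep P U (u + v) (f + g) (y + z) where
  ac := h.ac.add k.ac
  rep j := by
    filter_upwards [Lp.coeFn_add (u j) (v j), h.rep j, k.rep j] with x h1 h2 h3
    simpa [h2, h3] using h1
  bc := by
    have h1 := h.bc
    have h2 := k.bc
    simp only [boundaryForm, Pi.add_apply, Matrix.mulVec_add] at h1 h2 ⊢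
    rw [add_add_add_comm, h1, h2, add_zero]
  eqn j := by
    filter_upwards [Lp.coeFn_add (f j) (g j), h.eqn j, k.eqn j, ae_differentiableAt h.ac,
      ae_differentiableAt k.ac] with x h1 h2 h3 h4 h5
    have h6 : ((f + g) j : ℝ → ℂ) x = (f j : ℝ → ℂ) x + (g j : ℝ → ℂ) x := by simpa using h1
    rw [h6, h2, h3]
    simp only [diracExpr, deriv_add h4 h5, Pi.add_apply, Matrix.mulVec_add]
    ring

theorem IsRep.smul {P : ℝ → Matrix (Fin 2) (Fin 2) ℂ} {U : Matrix (Fin 2) (Fin 4) ℂ}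
    {u f : H} {y : ℝ → Fin 2 → ℂ} (c : ℂ) (h : IsRep P U u f y) :
    IsRep P U (c • u) (c • f) (fun x => c • y x) where
  ac := h.ac.const_smul c
  rep j := by
    filter_upwards [Lp.coeFn_smul c (u j), h.rep j] with x h1 h2
    simpa [h2] using h1
  bc := by
    have h1 := h.bc
    simp only [boundaryForm, Matrix.mulVec_smul] at h1 ⊢
    rw [← smul_add, h1, smul_zero]
  eqn j := by
    filter_upwards [Lp.coeFn_smul c (f j), h.eqn j, ae_differentiableAt h.ac] with x h1 h2 h4
    have h6 : ((c • f) j : ℝ → ℂ) x = c * (f j : ℝ → ℂ) x := by simpa using h1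
    rw [h6, h2]
    simp only [diracExpr, deriv_fun_const_smul c h4, Pi.add_apply, Matrix.mulVec_smul,
      Pi.smul_apply, smul_eq_mul]
    ring

theorem IsRep.zero (P : ℝ → Matrix (Fin 2) (Fin 2) ℂ) (U : Matrix (Fin 2) (Fin 4) ℂ) :
    IsRep P U 0 0 (fun _ => 0) where
  ac := (LipschitzWith.const (0 : Fin 2 → ℂ)).lipschitzOnWith.absolutelyContinuousOnInterval
  rep j := by
    filter_upwards [Lp.coeFn_zero ℂ 2 segMeasure] with x h1
    simpa using h1
  bc := by simp [boundaryForm]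
  eqn j := by
    filter_upwards [Lp.coeFn_zero ℂ 2 segMeasure] with x h1
    simpa [diracExpr] using h1

/-- The graph of the operator `L_{P,U}` in `H × H`. -/
def diracGraph (P : ℝ → Matrix (Fin 2) (Fin 2) ℂ) (U : Matrix (Fin 2) (Fin 4) ℂ) :
    Submodule ℂ (H × H) where
  carrier := {w | ∃ y, IsRep P U w.1 w.2 y}
  zero_mem' := ⟨_, IsRep.zero P U⟩
  add_mem' := by
    rintro _ _ ⟨y, hy⟩ ⟨z, hz⟩
    exact ⟨_, hy.add hz⟩
  smul_mem' := by
    rintro c _ ⟨y, hy⟩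
    exact ⟨_, hy.smul c⟩

/-- The graph relation is single-valued. -/
theorem diracGraph_singleValued (P : ℝ → Matrix (Fin 2) (Fin 2) ℂ)
    (U : Matrix (Fin 2) (Fin 4) ℂ) (w : H × H) (hw : w ∈ diracGraph P U) (h0 : w.1 = 0) :
    w.2 = 0 := by
  obtain ⟨y, hy⟩ := hw
  have hae : y =ᵐ[segMeasure] fun _ => 0 := by
    have hj : ∀ j, (fun x => y x j) =ᵐ[segMeasure] fun _ => 0 := by
      intro j
      have h1 := hy.rep j
      rw [h0] at h1
      filter_upwards [h1, Lp.coeFn_zero ℂ 2 segMeasure] with x h2 h3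
      rw [← h2]
      simpa using h3
    filter_upwards [hj 0, hj 1] with x h2 h3
    ext j
    fin_cases j
    · exact h2
    · exact h3
  have hcont : ContinuousOn y (Set.Icc 0 Real.pi) := by
    have := hy.ac.continuousOn
    rwa [Set.uIcc_of_le Real.pi_pos.le] at this
  have heq : Set.EqOn y (fun _ => 0) (Set.Icc 0 Real.pi) :=
    Measure.eqOn_Icc_of_ae_eq volume Real.pi_pos.ne hae hcont continuousOn_const
  have hIoo : ∀ᵐ x ∂segMeasure, x ∈ Set.Ioo 0 Real.pi := by
    have : segMeasure = volume.restrict (Set.Ioo 0 Real.pi) :=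
      (Measure.restrict_congr_set Ioo_ae_eq_Icc).symm
    rw [this]
    exact ae_restrict_mem measurableSet_Ioo
  refine PiLp.ext fun j => ?_
  refine Lp.ext ?_
  filter_upwards [hy.eqn j, hIoo, Lp.coeFn_zero ℂ 2 segMeasure] with x h1 h2 h3
  have hev : y =ᶠ[nhds x] fun _ => 0 := by
    filter_upwards [Ioo_mem_nhds h2.1 h2.2] with t ht
    exact heq ⟨ht.1.le, ht.2.le⟩
  have hd : deriv y x = 0 := by
    rw [hev.deriv_eq]
    simp
  have hx : y x = 0 := hev.eq_of_nhds
  rw [h1]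
  simp only [diracExpr, hd, hx, Matrix.mulVec_zero, add_zero]
  simpa using h3.symm

/-- The Dirac operator `L_{P,U}` in `H`: its domain consists of the `u ∈ H` that are absolutely
continuous on `[0,π]`, satisfy `U(u) = 0` and `ℓ_P(u) ∈ H`, and it acts as `ℓ_P`. -/
def diracOperator (P : ℝ → Matrix (Fin 2) (Fin 2) ℂ) (U : Matrix (Fin 2) (Fin 4) ℂ) :
    H →ₗ.[ℂ] H :=
  (diracGraph P U).toLinearPMap

theorem diracOperator_graph (P : ℝ → Matrix (Fin 2) (Fin 2) ℂ)
    (U : Matrix (Fin 2) (Fin 4) ℂ) : (diracOperator P U).graph = diracGraph P U :=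
  Submodule.toLinearPMap_graph_eq _ (diracGraph_singleValued P U)

/-- `u` is an eigenfunction, or an associated function of some order, of `A` for the eigenvalue
`z`: an eigenfunction is a nonzero `u` with `A u = z u`, and an associated function is a `u` with
`(A - z) u = v`, where `v` is an eigenfunction or an associated function for `z`. -/
inductive IsRootFunction (A : H →ₗ.[ℂ] H) (z : ℂ) : H → Prop
  | eigen (u : A.domain) (hne : (u : H) ≠ 0) (hu : A u = z • (u : H)) : IsRootFunction A z u
  | assoc (u : A.domain) (v : H) (hv : IsRootFunction A z v) (hu : A u = z • (u : H) + v) :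
      IsRootFunction A z u

/-- `(y n)` is a system of eigenfunctions and associated functions of `A`, with `y n` belonging to
the eigenvalue `ev n` (eigenvalues are repeated according to algebraic multiplicity): it is made
of chains of eigenfunctions and associated functions, is linearly independent, and for each
eigenvalue the corresponding members span the root subspace. -/
structure IsRootSystem (A : H →ₗ.[ℂ] H) (ev : ℤ → ℂ) (y : ℤ → H) : Prop where
  root : ∀ n, IsRootFunction A (ev n) (y n)
  chain : ∀ n, ∃ u : A.domain, (u : H) = y n ∧
    (A u = ev n • y n ∨ ∃ m, ev m = ev n ∧ A u = ev n • y n + y m)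
  linearIndependent : LinearIndependent ℂ y
  span : ∀ z u, IsRootFunction A z u → u ∈ Submodule.span ℂ (y '' {n | ev n = z})

/-- The set `S` of functions is contained in `(L_α[0,π])²` and is complete there: its linear span
is dense. -/
def IsCompleteIn (α : ℝ≥0∞) [Fact (1 ≤ α)] (S : Set H) : Prop :=
  (∀ u ∈ S, ∀ j, MemLp (u j : ℝ → ℂ) α segMeasure) ∧
  (Submodule.span ℂ {v : LpPair α | ∃ u ∈ S, ∀ j,
    (v j : ℝ → ℂ) =ᵐ[segMeasure] (u j : ℝ → ℂ)}).topologicalClosure = ⊤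

end DiracOp

end

noncomputable section

namespace DiracOp

open Set Filter Topology
open scoped BoundedContinuousFunction

/-! By Hahn–Banach it is enough that a functional `φ` on `LpPair α` which annihilates all root
functions is zero. For a source `g` in `L₁` let `y(λ)` solve `y' = B⁻¹(λ - P) y + g`, `U(y) = 0`.
Then `F(λ) = φ(y(λ))` could have poles only at eigenvalues, but the principal parts of `y(λ)` there
are built from root functions, so `F` is entire. Regularity makes `y(λ)` tend to zero uniformly on
`[0, π]` along the sides of growing rectangles, and the maximum principle gives `F = 0`. Every
absolutely continuous pair with `U(y) = 0` equals `y(λ₀)` for a suitable `g` in `L₁`, so `φ`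
annihilates all such pairs; among them are the `C¹` pairs vanishing at both endpoints, which are
dense when `α < ∞`.

Decay (`apriori_lower`, `apriori_upper`) needs no asymptotics of fundamental solutions. Each
component is integrated in its stable direction. In the remainder the potential is multiplied by the
other component, which itself carries an exponential, so the kernel that appears is `e^{2νt} q(t)`;
it is small by `riemann_lebesgue`, uniformly up to the real axis. The boundary conditions then
become a perturbed 2×2 linear system whose determinant `charPoly` is bounded below on the lines of
`exists_good_lines`.

Cancellation of poles (`exists_factor_of_pencil`, `exists_entire_quotient`) is pure algebra of an
affine pencil `A - λS`. An `L₁` source need not lie in `H`, so the pencil is set up with Volterra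
integral operators on bounded continuous functions. Only the chains at an eigenvalue have to be
recognised in `H`, and their right-hand sides are continuous (`rootPairs_chain`). -/

/-! ### Primitives of integrable functions and variation of constants -/

theorem _root_.AbsolutelyContinuousOnInterval.congr {X : Type*} [PseudoMetricSpace X]
    {f g : ℝ → X} {a b : ℝ} (hf : AbsolutelyContinuousOnInterval f a b)
    (h : EqOn f g (uIcc a b)) : AbsolutelyContinuousOnInterval g a b := by
  refine Tendsto.congr' ?_ hf
  filter_upwards [mem_inf_of_right (mem_principal_self _)] with E hE
  refine Finset.sum_congr rfl fun i hi => ?_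
  have := hE.1 i hi
  rw [h this.1, h this.2]

/-- Reduces to the real case through `f = Re f + i Im f`. -/
theorem absolutelyContinuousOnInterval_integral {f : ℝ → ℂ} {a b c : ℝ}
    (h : IntervalIntegrable f volume a b) (hc : c ∈ uIcc a b) :
    AbsolutelyContinuousOnInterval (fun x => ∫ t in c..x, f t) a b := by
  have hre : IntervalIntegrable (fun t => (f t).re) volume a b :=
    ⟨h.1.re, h.2.re⟩
  have him : IntervalIntegrable (fun t => (f t).im) volume a b :=
    ⟨h.1.im, h.2.im⟩
  have h1 := (hre.absolutelyContinuousOnInterval_intervalIntegral hc).smul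
    (LipschitzWith.const (1 : ℂ)).lipschitzOnWith.absolutelyContinuousOnInterval
  have h2 := (him.absolutelyContinuousOnInterval_intervalIntegral hc).smul
    (LipschitzWith.const (Complex.I : ℂ)).lipschitzOnWith.absolutelyContinuousOnInterval
  refine (h1.add h2).congr fun x hx => ?_
  have hcx : IntervalIntegrable f volume c x := h.mono_set (uIcc_subset_uIcc hc hx)
  simp only [Pi.add_apply, Pi.smul_apply', Complex.real_smul, mul_one]
  rw [← intervalIntegral.integral_ofReal, ← intervalIntegral.integral_ofReal,
    ← intervalIntegral.integral_mul_const, ← intervalIntegral.integral_add]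
  · refine intervalIntegral.integral_congr fun t _ => ?_
    simp
  · exact ⟨hcx.1.re.ofReal, hcx.2.re.ofReal⟩
  · have h3 : IntervalIntegrable (fun t => ((f t).im : ℂ)) volume c x :=
      ⟨hcx.1.im.ofReal, hcx.2.im.ofReal⟩
    exact h3.mul_const _

theorem intervalIntegrable_of_integrableOn {f : ℝ → ℂ} (hf : IntegrableOn f (Icc 0 Real.pi))
    {a b : ℝ} (ha : a ∈ Icc 0 Real.pi) (hb : b ∈ Icc 0 Real.pi) :
    IntervalIntegrable f volume a b := by
  rw [intervalIntegrable_iff]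
  refine hf.mono_set (uIoc_subset_uIcc.trans ?_)
  rw [← uIcc_of_le Real.pi_pos.le] at ha hb ⊢
  exact uIcc_subset_uIcc ha hb

theorem left_mem : (0 : ℝ) ∈ Icc 0 Real.pi := left_mem_Icc.2 Real.pi_pos.le

theorem right_mem : Real.pi ∈ Icc 0 Real.pi := right_mem_Icc.2 Real.pi_pos.le

/-- On `[0, π]`, the function `y` is a primitive of the integrable function `h`. -/
structure IsPrimitive (y h : ℝ → ℂ) : Prop where
  integrableOn : IntegrableOn h (Icc 0 Real.pi)
  eq : ∀ x ∈ Icc 0 Real.pi, y x = y 0 + ∫ t in (0 : ℝ)..x, h t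

namespace IsPrimitive

variable {y z h k : ℝ → ℂ}

theorem intervalIntegrable (hy : IsPrimitive y h) {a b : ℝ} (ha : a ∈ Icc 0 Real.pi)
    (hb : b ∈ Icc 0 Real.pi) : IntervalIntegrable h volume a b :=
  intervalIntegrable_of_integrableOn hy.integrableOn ha hb

theorem ac (hy : IsPrimitive y h) : AbsolutelyContinuousOnInterval y 0 Real.pi := by
  have h1 := absolutelyContinuousOnInterval_integral
    (hy.intervalIntegrable left_mem right_mem) left_mem_uIcc
  refine ((LipschitzWith.const (y 0)).lipschitzOnWith.absolutelyContinuousOnInterval.add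
    h1).congr fun x hx => ?_
  rw [uIcc_of_le Real.pi_pos.le] at hx
  simp [hy.eq x hx]

theorem continuousOn (hy : IsPrimitive y h) : ContinuousOn y (Icc 0 Real.pi) := by
  have := hy.ac.continuousOn
  rwa [uIcc_of_le Real.pi_pos.le] at this

theorem ae_Ioo (p : ℝ → Prop) (hp : ∀ᵐ x, x ∈ Ioo 0 Real.pi → p x) :
    ∀ᵐ x, x ∈ Icc 0 Real.pi → p x := by
  have h0 : ∀ᵐ x : ℝ, x ≠ 0 := by simp [ae_iff, measure_singleton]
  have h1 : ∀ᵐ x : ℝ, x ≠ Real.pi := by simp [ae_iff, measure_singleton]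
  filter_upwards [hp, h0, h1] with x hx h0 h1 hm
  exact hx ⟨lt_of_le_of_ne hm.1 h0.symm, lt_of_le_of_ne hm.2 h1⟩

theorem ae_hasDerivAt (hy : IsPrimitive y h) :
    ∀ᵐ x, x ∈ Icc 0 Real.pi → HasDerivAt y (h x) x := by
  refine ae_Ioo _ ?_
  filter_upwards [(hy.intervalIntegrable left_mem right_mem).ae_hasDerivAt_integral] with x hx hm
  rw [uIcc_of_le Real.pi_pos.le] at hx
  have h1 := (hx ⟨hm.1.le, hm.2.le⟩ 0 left_mem).const_add (y 0)
  refine h1.congr_of_eventuallyEq ?_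
  filter_upwards [Ioo_mem_nhds hm.1 hm.2] with t ht
  exact hy.eq t ⟨ht.1.le, ht.2.le⟩

/-- The difference between `y` and the indefinite integral of `h` is absolutely continuous with zero
derivative almost everywhere, hence constant. This yields the product rule `mul`, and with it
integration by parts when the derivatives are only in `L₁`. -/
theorem of_ac (hy : AbsolutelyContinuousOnInterval y 0 Real.pi)
    (hh : IntegrableOn h (Icc 0 Real.pi))
    (hd : ∀ᵐ x, x ∈ Icc 0 Real.pi → HasDerivAt y (h x) x) : IsPrimitive y h := by
  refine ⟨hh, ?_⟩
  have hi := intervalIntegrable_of_integrableOn hh left_mem right_mem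
  have h1 := absolutelyContinuousOnInterval_integral hi left_mem_uIcc
  obtain ⟨C, hC⟩ := (hy.sub h1).const_of_ae_hasDerivAt_zero (by
    filter_upwards [hd, hi.ae_hasDerivAt_integral] with x hx hx' hm
    have h2 := hx' hm 0 left_mem_uIcc
    rw [uIcc_of_le Real.pi_pos.le] at hm
    simpa using (hx hm).sub h2)
  rw [uIcc_of_le Real.pi_pos.le] at hC
  intro x hx
  have e0 := hC 0 left_mem
  have e1 := hC x hx
  simp only [Pi.sub_apply, intervalIntegral.integral_same, sub_zero] at e0 e1
  rw [e0, ← e1]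
  ring

theorem mul (hy : IsPrimitive y h) (hz : IsPrimitive z k) :
    IsPrimitive (fun t => y t * z t) (fun t => h t * z t + y t * k t) := by
  refine of_ac (hy.ac.smul hz.ac) ?_ ?_
  · exact (hy.integrableOn.mul_continuousOn hz.continuousOn isCompact_Icc).add
      (hz.integrableOn.continuousOn_mul hy.continuousOn isCompact_Icc)
  · filter_upwards [hy.ae_hasDerivAt, hz.ae_hasDerivAt] with x h1 h2 hm
    exact (h1 hm).mul (h2 hm)

theorem congr (hy : IsPrimitive y h) (hk : ∀ t, h t = k t) : IsPrimitive y k := by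
  have : h = k := funext hk
  rwa [← this]

theorem integral_eq (hy : IsPrimitive y h) {a b : ℝ} (ha : a ∈ Icc 0 Real.pi)
    (hb : b ∈ Icc 0 Real.pi) : ∫ t in a..b, h t = y b - y a := by
  rw [hy.eq a ha, hy.eq b hb, ← intervalIntegral.integral_interval_sub_left
    (hy.intervalIntegrable left_mem hb) (hy.intervalIntegrable left_mem ha)]
  ring

theorem of_hasDerivAt (hd : ∀ x, HasDerivAt y (h x) x) (hc : Continuous h) : IsPrimitive y h := by
  refine ⟨hc.continuousOn.integrableOn_Icc, fun x _ => ?_⟩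
  rw [intervalIntegral.integral_eq_sub_of_hasDerivAt (fun t _ => hd t)
    (hc.intervalIntegrable _ _)]
  ring

theorem exp (c : ℂ) : IsPrimitive (fun t : ℝ => Complex.exp (c * t))
    (fun t : ℝ => c * Complex.exp (c * t)) := by
  refine of_hasDerivAt (fun x => ?_) (by fun_prop)
  have h1 : HasDerivAt (fun t : ℝ => c * (t : ℂ)) c x := by
    simpa using (Complex.ofRealCLM.hasDerivAt (x := x)).const_mul c
  simpa [mul_comm] using h1.cexp

/-- Variation of constants for `y' = μ y + g`. -/
theorem variation {g : ℝ → ℂ} {μ : ℂ} (hy : IsPrimitive y (fun t => μ * y t + g t)) {a b : ℝ}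
    (ha : a ∈ Icc 0 Real.pi) (hb : b ∈ Icc 0 Real.pi) :
    y b = Complex.exp (μ * (b - a)) * y a + ∫ t in a..b, Complex.exp (μ * (b - t)) * g t := by
  have h1 := ((hy.mul (exp (-μ))).congr (k := fun t => Complex.exp (-μ * t) * g t)
    (fun t => by ring)).integral_eq ha hb
  have h2 : ∫ t in a..b, Complex.exp (μ * (b - t)) * g t =
      Complex.exp (μ * b) * ∫ t in a..b, Complex.exp (-μ * t) * g t := by
    rw [← intervalIntegral.integral_const_mul]
    refine intervalIntegral.integral_congr fun t _ => ?_
    rw [← mul_assoc, ← Complex.exp_add]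
    ring_nf
  rw [h2, h1, mul_sub, mul_sub, Complex.exp_sub, neg_mul, neg_mul, Complex.exp_neg,
    Complex.exp_neg]
  have := Complex.exp_ne_zero (μ * a)
  have := Complex.exp_ne_zero (μ * b)
  field_simp
  ring

end IsPrimitive

/-! ### Exponential integrals with complex frequency -/

/-- Between `x` and `b` the difference `t - x` has the sign of `b - x` or is zero. No order of `x`
and `b` is imposed, so integration may run towards either endpoint of the segment. -/
theorem norm_exp_le_one {ν : ℂ} {x b t : ℝ} (hν : ν.re * (b - x) ≤ 0) (ht : t ∈ uIcc x b) :
    ‖Complex.exp (ν * (t - x))‖ ≤ 1 := by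
  rw [Complex.norm_exp]
  refine Real.exp_le_one_iff.2 ?_
  have : (ν * (t - x)).re = ν.re * (t - x) := by simp
  rw [this]
  rcases le_total x b with h | h
  · rw [uIcc_of_le h] at ht
    rcases h.eq_or_lt with h | h
    · have : t = x := le_antisymm (h ▸ ht.2) ht.1
      simp [this]
    · have : ν.re ≤ 0 := by nlinarith
      nlinarith [ht.1]
  · rw [uIcc_of_ge h] at ht
    rcases h.eq_or_lt with h | h
    · have : t = x := le_antisymm ht.2 (h ▸ ht.1)
      simp [this]
    · have : 0 ≤ ν.re := by nlinarith
      nlinarith [ht.2]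

theorem uIcc_subset_seg {a b : ℝ} (ha : a ∈ Icc 0 Real.pi) (hb : b ∈ Icc 0 Real.pi) :
    uIcc a b ⊆ Icc 0 Real.pi := by
  rw [← uIcc_of_le Real.pi_pos.le] at ha hb ⊢
  exact uIcc_subset_uIcc ha hb

/-- The `L₁[0,π]` norm. -/
def normL1 (f : ℝ → ℂ) : ℝ := ∫ t in Icc 0 Real.pi, ‖f t‖

theorem normL1_nonneg (f : ℝ → ℂ) : 0 ≤ normL1 f := integral_nonneg fun _ => norm_nonneg _

theorem norm_integral_mul_le {f g : ℝ → ℂ} {a b c : ℝ} (hf : IntegrableOn f (Icc 0 Real.pi))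
    (ha : a ∈ Icc 0 Real.pi) (hb : b ∈ Icc 0 Real.pi)
    (hc : ∀ t ∈ uIcc a b, ‖g t‖ ≤ c) :
    ‖∫ t in a..b, g t * f t‖ ≤ c * normL1 f := by
  have hc0 : 0 ≤ c := (norm_nonneg _).trans (hc a left_mem_uIcc)
  refine intervalIntegral.norm_integral_le_integral_norm_uIoc.trans ?_
  have hs : uIoc a b ⊆ Icc 0 Real.pi := uIoc_subset_uIcc.trans (uIcc_subset_seg ha hb)
  calc ∫ t in uIoc a b, ‖g t * f t‖ ≤ ∫ t in uIoc a b, c * ‖f t‖ := by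
        refine integral_mono_of_nonneg (Eventually.of_forall fun _ => norm_nonneg _)
          ((hf.mono_set hs).norm.const_mul c) ?_
        refine (ae_restrict_iff' measurableSet_uIoc).2 (Eventually.of_forall fun t ht => ?_)
        simp only [norm_mul]
        exact mul_le_mul_of_nonneg_right (hc t (uIoc_subset_uIcc ht)) (norm_nonneg _)
    _ ≤ ∫ t in Icc 0 Real.pi, c * ‖f t‖ := by
        refine setIntegral_mono_set (hf.norm.const_mul c)
          (Eventually.of_forall fun _ => mul_nonneg hc0 (norm_nonneg _)) hs.eventuallyLE
    _ = c * normL1 f := by rw [integral_const_mul, normL1]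

/-- A Riemann–Lebesgue lemma, uniform in the complex frequencies for which the exponential does
not exceed `1`. -/
theorem riemann_lebesgue {p : ℝ → ℂ} (hp : IntegrableOn p (Icc 0 Real.pi)) {ε : ℝ} (hε : 0 < ε) :
    ∃ R, ∀ ν : ℂ, R ≤ ‖ν‖ → ∀ a ∈ Icc 0 Real.pi, ∀ b ∈ Icc 0 Real.pi, ν.re * (b - a) ≤ 0 →
      ‖∫ t in a..b, Complex.exp (ν * (t - a)) * p t‖ ≤ ε := by
  -- A smooth `g` within `ε / 2` of `p` in `L₁`: the difference costs `ε / 2` for every admissible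
  -- frequency, and integration by parts gains a factor `1 / ‖ν‖` on `g`.
  obtain ⟨g, -, hg, hpg⟩ := (memLp_one_iff_integrable.2 hp).exist_eLpNorm_sub_le
    ENNReal.one_ne_top le_rfl (half_pos hε)
  have hg1 : ContDiff ℝ 1 g := hg.of_le (by exact_mod_cast le_top)
  have hgc : Continuous g := hg1.continuous
  have hdc : Continuous (deriv g) := hg1.continuous_deriv le_rfl
  obtain ⟨A, hA⟩ := isCompact_Icc.exists_bound_of_continuousOn
    (hgc.continuousOn (s := Icc 0 Real.pi))
  have hA0 : 0 ≤ A := (norm_nonneg _).trans (hA 0 left_mem)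
  have hgi : IntegrableOn g (Icc 0 Real.pi) := hgc.continuousOn.integrableOn_Icc
  have hdi : IntegrableOn (deriv g) (Icc 0 Real.pi) := hdc.continuousOn.integrableOn_Icc
  have hsub : normL1 (fun t => p t - g t) ≤ ε / 2 := by
    have h1 := integral_norm_eq_lintegral_enorm (hp.sub hgi).aestronglyMeasurable
    rw [eLpNorm_one_eq_lintegral_enorm] at hpg
    simp only [Pi.sub_apply] at h1 hpg
    rw [normL1, h1]
    exact ENNReal.toReal_le_of_le_ofReal (half_pos hε).le hpg
  have hprim : IsPrimitive g (deriv g) := IsPrimitive.of_hasDerivAt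
    (fun x => (hg1.differentiable one_ne_zero x).hasDerivAt) hdc
  set D := normL1 (deriv g)
  have hD0 : 0 ≤ D := normL1_nonneg _
  -- After integration by parts the two boundary terms give at most `2 * A` and the integral of `g'`
  -- at most `D`. The final `+ 1` forces `ν ≠ 0`.
  refine ⟨(2 * A + D) / (ε / 2) + 1, fun ν hν a ha b hb hab => ?_⟩
  have hR : 0 ≤ (2 * A + D) / (ε / 2) := by positivity
  have hν0 : 0 < ‖ν‖ := by linarith
  have hexp : ∀ t ∈ uIcc a b, ‖Complex.exp (ν * (t - a))‖ ≤ 1 := fun t ht =>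
    norm_exp_le_one hab ht
  have hparts : ν * ∫ t in a..b, Complex.exp (ν * (t - a)) * g t =
      Complex.exp (ν * (b - a)) * g b - g a -
        ∫ t in a..b, Complex.exp (ν * (t - a)) * deriv g t := by
    have h1 := ((IsPrimitive.exp ν).mul hprim).integral_eq ha hb
    have hE : Continuous fun t : ℝ => Complex.exp (ν * t) := by fun_prop
    rw [intervalIntegral.integral_add
      ((by fun_prop : Continuous fun t : ℝ => ν * Complex.exp (ν * t) * g t).intervalIntegrable _ _)
      ((by fun_prop : Continuous fun t : ℝ =>
        Complex.exp (ν * t) * deriv g t).intervalIntegrable _ _)] at h1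
    have e : ∀ t : ℝ, Complex.exp (ν * (t - a)) = Complex.exp (-(ν * a)) * Complex.exp (ν * t) := by
      intro t
      rw [← Complex.exp_add]
      ring_nf
    have e0 : Complex.exp (-(ν * a)) * Complex.exp (ν * a) = 1 := by
      rw [← Complex.exp_add, neg_add_cancel, Complex.exp_zero]
    simp only [e, mul_assoc, intervalIntegral.integral_const_mul] at h1 ⊢
    linear_combination Complex.exp (-(ν * a)) * h1 - g a * e0
  have hgb : ‖∫ t in a..b, Complex.exp (ν * (t - a)) * g t‖ ≤ ε / 2 := by
    have h2 : ‖ν * ∫ t in a..b, Complex.exp (ν * (t - a)) * g t‖ ≤ 2 * A + D := by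
      rw [hparts]
      have h3 := norm_integral_mul_le hdi ha hb hexp
      have h4 : ‖Complex.exp (ν * (b - a)) * g b‖ ≤ 1 * A := by
        rw [norm_mul]
        exact mul_le_mul (hexp b right_mem_uIcc) (hA b hb) (norm_nonneg _) zero_le_one
      have h5 := hA a ha
      have h6 := norm_sub_le (Complex.exp (ν * (b - a)) * g b - g a)
        (∫ t in a..b, Complex.exp (ν * (t - a)) * deriv g t)
      have h7 := norm_sub_le (Complex.exp (ν * (b - a)) * g b) (g a)
      linarith
    rw [norm_mul] at h2
    have h3 : (2 * A + D) ≤ ‖ν‖ * (ε / 2) := by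
      rw [← div_le_iff₀ (half_pos hε)]
      linarith
    exact le_of_mul_le_mul_left (h2.trans h3) hν0
  have hpb : ‖∫ t in a..b, Complex.exp (ν * (t - a)) * (p t - g t)‖ ≤ ε / 2 := by
    have := norm_integral_mul_le (hp.sub hgi) ha hb hexp
    simp only [Pi.sub_apply] at this
    refine this.trans ?_
    rw [one_mul]
    exact hsub
  have hE : Continuous fun t : ℝ => Complex.exp (ν * (t - a)) := by fun_prop
  have hsum : ∫ t in a..b, Complex.exp (ν * (t - a)) * p t =
      (∫ t in a..b, Complex.exp (ν * (t - a)) * (p t - g t)) +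
        ∫ t in a..b, Complex.exp (ν * (t - a)) * g t := by
    rw [← intervalIntegral.integral_add]
    · refine intervalIntegral.integral_congr fun t _ => ?_
      ring
    · exact (intervalIntegrable_of_integrableOn (hp.sub hgi) ha hb).continuousOn_mul hE.continuousOn
    · exact (hE.mul hgc).intervalIntegrable _ _
  rw [hsum]
  exact (norm_add_le _ _).trans (by linarith)

/-- If `y' = ν y + h`, then the integral of `e^{ν(t-x)} p y` is controlled by the oscillation of
`e^{2ν t} p`. -/
theorem norm_integral_exp_mul_le {p y h : ℝ → ℂ} (hp : IntegrableOn p (Icc 0 Real.pi)) {ν : ℂ}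
    (hy : IsPrimitive y (fun t => ν * y t + h t)) (hh : IntegrableOn h (Icc 0 Real.pi))
    {x b ε : ℝ} (hx : x ∈ Icc 0 Real.pi) (hb : b ∈ Icc 0 Real.pi) (hν : ν.re * (b - x) ≤ 0)
    (hε : ∀ t : ℝ, t ∈ uIcc x b → ‖∫ s in t..b, Complex.exp (2 * ν * (s - t)) * p s‖ ≤ ε) :
    ‖∫ t in x..b, Complex.exp (ν * (t - x)) * (p t * y t)‖ ≤ ε * (‖y x‖ + normL1 h) := by
  have hq : IntegrableOn (fun t : ℝ => Complex.exp (2 * ν * t) * p t) (Icc 0 Real.pi) :=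
    hp.continuousOn_mul (by fun_prop) isCompact_Icc
  have hqi : ∀ {a c : ℝ}, a ∈ Icc 0 Real.pi → c ∈ Icc 0 Real.pi →
      IntervalIntegrable (fun t : ℝ => Complex.exp (2 * ν * t) * p t) volume a c := fun ha hc =>
    intervalIntegrable_of_integrableOn hq ha hc
  -- The integrand is `e^{-νx}` times `e^{2νt} p` times `e^{-νt} y`. The middle factor is `-k'`, and
  -- the last has derivative `e^{-νt} h`, free of `ν`; so the product rule for `k · e^{-νt} y`
  -- brings in no large factor. Since `k b = 0`, only the boundary term at `x` survives.
  set k : ℝ → ℂ := fun t => ∫ s in t..b, Complex.exp (2 * ν * s) * p s with hk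
  have hkp : IsPrimitive k (fun t : ℝ => -(Complex.exp (2 * ν * t) * p t)) := by
    refine ⟨hq.neg, fun t ht => ?_⟩
    rw [intervalIntegral.integral_neg, hk]
    simp only
    rw [← intervalIntegral.integral_add_adjacent_intervals (hqi left_mem ht) (hqi ht hb)]
    ring
  have hu : IsPrimitive (fun t : ℝ => Complex.exp (-ν * t) * y t)
      (fun t : ℝ => Complex.exp (-ν * t) * h t) :=
    ((IsPrimitive.exp (-ν)).mul hy).congr fun t => by ring
  have hku := hkp.mul hu
  have hkt : ∀ t, k t = Complex.exp (2 * ν * t) *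
      ∫ s in t..b, Complex.exp (2 * ν * (s - t)) * p s := by
    intro t
    rw [hk, ← intervalIntegral.integral_const_mul]
    refine intervalIntegral.integral_congr fun s _ => ?_
    rw [← mul_assoc, ← Complex.exp_add]
    ring_nf
  have hI := hku.integral_eq hx hb
  have hkb : k b = 0 := by simp [hk]
  have i1 : IntervalIntegrable (fun t : ℝ => -(Complex.exp (2 * ν * t) * p t) *
      (Complex.exp (-ν * t) * y t)) volume x b :=
    intervalIntegrable_of_integrableOn
      (hkp.integrableOn.mul_continuousOn hu.continuousOn isCompact_Icc) hx hb
  have i2 : IntervalIntegrable (fun t => k t * (Complex.exp (-ν * t) * h t)) volume x b :=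
    intervalIntegrable_of_integrableOn
      (hu.integrableOn.continuousOn_mul hkp.continuousOn isCompact_Icc) hx hb
  rw [intervalIntegral.integral_add i1 i2, hkb, zero_mul, zero_sub] at hI
  have e1 : ∫ t in x..b, Complex.exp (ν * (t - x)) * (p t * y t) =
      -Complex.exp (-ν * x) * ∫ t in x..b, -(Complex.exp (2 * ν * t) * p t) *
      (Complex.exp (-ν * t) * y t) := by
    rw [← intervalIntegral.integral_const_mul]
    refine intervalIntegral.integral_congr fun t _ => ?_
    have : Complex.exp (ν * (t - x)) =
        Complex.exp (-ν * x) * Complex.exp (2 * ν * t) * Complex.exp (-ν * t) := by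
      rw [← Complex.exp_add, ← Complex.exp_add]
      ring_nf
    simp only [this]
    ring
  have e2 : Complex.exp (-ν * x) * ∫ t in x..b, k t * (Complex.exp (-ν * t) * h t) =
      ∫ t in x..b, (Complex.exp (ν * (t - x)) *
        ∫ s in t..b, Complex.exp (2 * ν * (s - t)) * p s) * h t := by
    rw [← intervalIntegral.integral_const_mul]
    refine intervalIntegral.integral_congr fun t _ => ?_
    have : Complex.exp (ν * (t - x)) =
        Complex.exp (-ν * x) * Complex.exp (2 * ν * t) * Complex.exp (-ν * t) := by
      rw [← Complex.exp_add, ← Complex.exp_add]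
      ring_nf
    simp only [this, hkt]
    ring
  have e3 : Complex.exp (-ν * x) * (k x * (Complex.exp (-ν * x) * y x)) =
      (∫ s in x..b, Complex.exp (2 * ν * (s - x)) * p s) * y x := by
    have : Complex.exp (-ν * x) * Complex.exp (2 * ν * x) * Complex.exp (-ν * x) = 1 := by
      rw [← Complex.exp_add, ← Complex.exp_add]
      ring_nf
      exact Complex.exp_zero
    rw [hkt]
    linear_combination (∫ s in x..b, Complex.exp (2 * ν * (s - x)) * p s) * y x * this
  have e4 : ∫ t in x..b, Complex.exp (ν * (t - x)) * (p t * y t) =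
      (∫ s in x..b, Complex.exp (2 * ν * (s - x)) * p s) * y x +
      ∫ t in x..b, (Complex.exp (ν * (t - x)) *
        ∫ s in t..b, Complex.exp (2 * ν * (s - t)) * p s) * h t := by
    rw [e1, ← e2, ← e3]
    linear_combination -Complex.exp (-ν * x) * hI
  rw [e4, mul_add]
  refine (norm_add_le _ _).trans (add_le_add ?_ ?_)
  · rw [norm_mul]
    exact mul_le_mul_of_nonneg_right (hε x left_mem_uIcc) (norm_nonneg _)
  · refine norm_integral_mul_le hh hx hb fun t ht => ?_
    rw [norm_mul]
    have := mul_le_mul (norm_exp_le_one hν ht) (hε t ht) (norm_nonneg _) zero_le_one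
    rwa [one_mul] at this

/-! ### A priori estimate for the boundary value problem -/

/-- On `[0, π]`, the pair `(y₁, y₂)` solves `y₁' = iλ y₁ + q₁ y₂ + g₁`, `y₂' = -iλ y₂ + q₂ y₁ + g₂`. -/
structure IsSol (q₁ q₂ g₁ g₂ : ℝ → ℂ) (l : ℂ) (y₁ y₂ : ℝ → ℂ) : Prop where
  fst : IsPrimitive y₁ (fun t => Complex.I * l * y₁ t + (q₁ t * y₂ t + g₁ t))
  snd : IsPrimitive y₂ (fun t => -(Complex.I * l) * y₂ t + (q₂ t * y₁ t + g₂ t))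

/-- This symmetry reduces the upper half-plane to the lower one. -/
theorem IsSol.swap {q₁ q₂ g₁ g₂ : ℝ → ℂ} {l : ℂ} {y₁ y₂ : ℝ → ℂ}
    (h : IsSol q₁ q₂ g₁ g₂ l y₁ y₂) : IsSol q₂ q₁ g₂ g₁ (-l) y₂ y₁ :=
  ⟨h.snd.congr fun t => by ring, h.fst.congr fun t => by ring⟩

/-- The boundary conditions `C y(0) + D y(π) = 0`, written for the two components of `y`. -/
def BCond (U : Matrix (Fin 2) (Fin 4) ℂ) (y₁ y₂ : ℝ → ℂ) : Prop :=
  ∀ i, U i 0 * y₁ 0 + U i 1 * y₂ 0 + U i 2 * y₁ Real.pi + U i 3 * y₂ Real.pi = 0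

/-- The characteristic polynomial of the unperturbed boundary problem in `w = e^{-iπλ}`. -/
def charPoly (U : Matrix (Fin 2) (Fin 4) ℂ) (w : ℂ) : ℂ :=
  (U 0 2 + w * U 0 0) * (U 1 1 + w * U 1 3) - (U 1 2 + w * U 1 0) * (U 0 1 + w * U 0 3)

/-- Variation of constants from `b`, the endpoint from which the exponential does not grow. In the
coupling term `z` satisfies an equation with the opposite exponent to that of `y`, so
`norm_integral_exp_mul_le` applies and the small `η` multiplies the sizes of `z` and `h`. -/
theorem norm_sub_exp_mul_le {q y z g h : ℝ → ℂ} {ν : ℂ} {b x η m : ℝ}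
    (hq : IntegrableOn q (Icc 0 Real.pi)) (hg : IntegrableOn g (Icc 0 Real.pi))
    (hh : IntegrableOn h (Icc 0 Real.pi))
    (hy : IsPrimitive y (fun t => -ν * y t + (q t * z t + g t)))
    (hz : IsPrimitive z (fun t => ν * z t + h t))
    (hx : x ∈ Icc 0 Real.pi) (hb : b ∈ Icc 0 Real.pi) (hν : ν.re * (b - x) ≤ 0)
    (hη : ∀ t : ℝ, t ∈ uIcc x b → ‖∫ s in t..b, Complex.exp (2 * ν * (s - t)) * q s‖ ≤ η)
    (hη' : ‖∫ t in x..b, Complex.exp (ν * (t - x)) * g t‖ ≤ η) (hm : ‖z x‖ ≤ m) :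
    ‖y x - Complex.exp (ν * (b - x)) * y b‖ ≤ η * (m + normL1 h) + η := by
  have h1 := hy.variation hb hx
  have hη0 : 0 ≤ η := (norm_nonneg _).trans hη'
  have i1 : IntervalIntegrable (fun t : ℝ => Complex.exp (ν * (t - x)) * (q t * z t)) volume x b :=
    intervalIntegrable_of_integrableOn ((hq.mul_continuousOn hz.continuousOn
      isCompact_Icc).continuousOn_mul (by fun_prop) isCompact_Icc) hx hb
  have i2 : IntervalIntegrable (fun t : ℝ => Complex.exp (ν * (t - x)) * g t) volume x b :=
    intervalIntegrable_of_integrableOn (hg.continuousOn_mul (by fun_prop) isCompact_Icc) hx hb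
  have h2 : y x - Complex.exp (ν * (b - x)) * y b =
      -((∫ t in x..b, Complex.exp (ν * (t - x)) * (q t * z t)) +
        ∫ t in x..b, Complex.exp (ν * (t - x)) * g t) := by
    rw [← intervalIntegral.integral_add i1 i2, h1, intervalIntegral.integral_symm]
    have e1 : -ν * ((x : ℂ) - b) = ν * (b - x) := by ring
    rw [e1, add_sub_cancel_left]
    congr 1
    refine intervalIntegral.integral_congr fun t _ => ?_
    have e2 : -ν * ((x : ℂ) - t) = ν * (t - x) := by ring
    simp only [e2]
    ring
  rw [h2, norm_neg]
  have h3 := norm_integral_exp_mul_le hq hz hh hx hb hν hη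
  have h4 : η * (‖z x‖ + normL1 h) ≤ η * (m + normL1 h) := by gcongr
  exact (norm_add_le _ _).trans (add_le_add (h3.trans h4) hη')

theorem normL1_mul_add_le {q z g : ℝ → ℂ} {m : ℝ} (hq : IntegrableOn q (Icc 0 Real.pi))
    (hg : IntegrableOn g (Icc 0 Real.pi)) (hz : ∀ x ∈ Icc 0 Real.pi, ‖z x‖ ≤ m) :
    normL1 (fun t => q t * z t + g t) ≤ m * normL1 q + normL1 g := by
  rw [normL1, normL1, normL1, ← integral_const_mul, ← integral_add (hq.norm.const_mul m) hg.norm]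
  refine integral_mono_of_nonneg (Eventually.of_forall fun _ => norm_nonneg _)
    ((hq.norm.const_mul m).add hg.norm) ?_
  refine (ae_restrict_iff' measurableSet_Icc).2 (Eventually.of_forall fun t ht => ?_)
  refine (norm_add_le _ _).trans ?_
  simp only [norm_mul]
  have := mul_le_mul_of_nonneg_left (hz t ht) (norm_nonneg (q t))
  linarith

/-- Cramer's rule bound for an approximate kernel vector. -/
theorem norm_le_of_charPoly {U : Matrix (Fin 2) (Fin 4) ℂ} {K δ e : ℝ} {w a b r₁ r₂ : ℂ}
    (hK : ∀ i j, ‖U i j‖ ≤ K) (hδ : 0 < δ) (hw : ‖w‖ ≤ 1) (hc : δ ≤ ‖charPoly U w‖)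
    (h₁ : ‖r₁ - w * a‖ ≤ e) (h₂ : ‖r₂ - w * b‖ ≤ e)
    (hU : ∀ i, U i 0 * r₁ + U i 1 * b + U i 2 * a + U i 3 * r₂ = 0) :
    ‖a‖ ≤ 8 * K ^ 2 / δ * e ∧ ‖b‖ ≤ 8 * K ^ 2 / δ * e := by
  have hK0 : 0 ≤ K := (norm_nonneg _).trans (hK 0 0)
  have hr : ∀ i, ‖U i 0 * (r₁ - w * a) + U i 3 * (r₂ - w * b)‖ ≤ 2 * K * e := by
    intro i
    refine (norm_add_le _ _).trans ?_
    rw [norm_mul, norm_mul]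
    have h3 := mul_le_mul (hK i 0) h₁ (norm_nonneg _) hK0
    have h4 := mul_le_mul (hK i 3) h₂ (norm_nonneg _) hK0
    linarith
  have hs : ∀ i j k, ‖U i j + w * U i k‖ ≤ 2 * K := by
    intro i j k
    refine (norm_add_le _ _).trans ?_
    rw [norm_mul]
    have h3 := mul_le_mul hw (hK i k) (norm_nonneg _) zero_le_one
    linarith [hK i j]
  have key : ∀ c : ℂ, ∀ s t : ℂ, ‖s‖ ≤ 2 * K → ‖t‖ ≤ 2 * K →
      c * charPoly U w = s * (U 0 0 * (r₁ - w * a) + U 0 3 * (r₂ - w * b)) +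
        t * (U 1 0 * (r₁ - w * a) + U 1 3 * (r₂ - w * b)) → ‖c‖ ≤ 8 * K ^ 2 / δ * e := by
    intro c s t hs ht h
    have h3 : ‖c * charPoly U w‖ ≤ 8 * K ^ 2 * e := by
      rw [h]
      refine (norm_add_le _ _).trans ?_
      rw [norm_mul, norm_mul]
      have h5 := mul_le_mul hs (hr 0) (norm_nonneg _) (by positivity)
      have h6 := mul_le_mul ht (hr 1) (norm_nonneg _) (by positivity)
      nlinarith
    rw [norm_mul] at h3
    rw [div_mul_eq_mul_div, le_div_iff₀ hδ]
    exact (mul_le_mul_of_nonneg_left hc (norm_nonneg _)).trans h3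
  constructor
  · refine key a (-(U 1 1 + w * U 1 3)) (U 0 1 + w * U 0 3) (by rw [norm_neg]; exact hs _ _ _)
      (hs _ _ _) ?_
    rw [charPoly]
    linear_combination (U 1 1 + w * U 1 3) * hU 0 - (U 0 1 + w * U 0 3) * hU 1
  · refine key b (U 1 2 + w * U 1 0) (-(U 0 2 + w * U 0 0)) (hs _ _ _)
      (by rw [norm_neg]; exact hs _ _ _) ?_
    rw [charPoly]
    linear_combination -(U 1 2 + w * U 1 0) * hU 0 + (U 0 2 + w * U 0 0) * hU 1

/-- The a priori estimate in the closed lower half-plane. -/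
theorem apriori_lower {q₁ q₂ g₁ g₂ : ℝ → ℂ} (hq₁ : IntegrableOn q₁ (Icc 0 Real.pi))
    (hq₂ : IntegrableOn q₂ (Icc 0 Real.pi)) (hg₁ : IntegrableOn g₁ (Icc 0 Real.pi))
    (hg₂ : IntegrableOn g₂ (Icc 0 Real.pi)) (U : Matrix (Fin 2) (Fin 4) ℂ) {δ ε : ℝ}
    (hδ : 0 < δ) (hε : 0 < ε) :
    ∃ R, ∀ l : ℂ, l.im ≤ 0 → R ≤ ‖l‖ → δ ≤ ‖charPoly U (Complex.exp (-(Complex.I * l) * Real.pi))‖ →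
      ∀ y₁ y₂ : ℝ → ℂ, IsSol q₁ q₂ g₁ g₂ l y₁ y₂ → BCond U y₁ y₂ →
        ∀ x ∈ Icc 0 Real.pi, ‖y₁ x‖ ≤ ε ∧ ‖y₂ x‖ ≤ ε := by
  obtain ⟨K, hK⟩ : ∃ K : ℝ, ∀ i j, ‖U i j‖ ≤ K :=
    ⟨∑ i, ∑ j, ‖U i j‖, fun i j =>
      (Finset.single_le_sum (f := fun j => ‖U i j‖) (fun _ _ => norm_nonneg _)
        (Finset.mem_univ j)).trans (Finset.single_le_sum (f := fun i => ∑ j, ‖U i j‖)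
        (fun _ _ => Finset.sum_nonneg fun _ _ => norm_nonneg _) (Finset.mem_univ i))⟩
  set Q := normL1 q₁ + normL1 q₂ with hQ
  set G := normL1 g₁ + normL1 g₂
  have hq₁0 := normL1_nonneg q₁
  have hq₂0 := normL1_nonneg q₂
  have hg₁0 := normL1_nonneg g₁
  have hg₂0 := normL1_nonneg g₂
  -- `8 * K ^ 2 / δ` is the Cramer bound for `y₁ π` and `y₂ 0`; the `1` pays for the distance of the
  -- solution from its pure exponential. The choice of `η` below turns the resulting `m ≤ Λ * e`
  -- into `m ≤ m / 2 + ε / 2`.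
  set Λ := 8 * K ^ 2 / δ + 1 with hΛ
  obtain ⟨η, hη, hη1, hη2⟩ : ∃ η : ℝ, 0 < η ∧ Λ * η * (1 + Q) ≤ 1 / 2 ∧
      2 * (Λ * η * (G + 1)) ≤ ε := by
    have hQ1 : 0 < 2 * Λ * (1 + Q) := by positivity
    have hG1 : 0 < 2 * Λ * (G + 1) := by positivity
    refine ⟨min (1 / (2 * Λ * (1 + Q))) (ε / (2 * Λ * (G + 1))), by positivity, ?_, ?_⟩
    · have := (le_div_iff₀ hQ1).1 (min_le_left (1 / (2 * Λ * (1 + Q))) (ε / (2 * Λ * (G + 1))))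
      linarith
    · have := (le_div_iff₀ hG1).1 (min_le_right (1 / (2 * Λ * (1 + Q))) (ε / (2 * Λ * (G + 1))))
      linarith
  obtain ⟨R₁, hR₁⟩ := riemann_lebesgue hq₁ hη
  obtain ⟨R₂, hR₂⟩ := riemann_lebesgue hq₂ hη
  obtain ⟨R₃, hR₃⟩ := riemann_lebesgue hg₁ hη
  obtain ⟨R₄, hR₄⟩ := riemann_lebesgue hg₂ hη
  refine ⟨max (max R₁ R₂) (max R₃ R₄), fun l hl hR hc y₁ y₂ hs hbc => ?_⟩
  simp only [max_le_iff] at hR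
  obtain ⟨⟨hl₁, hl₂⟩, hl₃, hl₄⟩ := hR
  have n1 : ‖Complex.I * l‖ = ‖l‖ := by simp
  have n2 : ‖-(Complex.I * l)‖ = ‖l‖ := by simp
  have n3 : ‖l‖ ≤ ‖2 * (Complex.I * l)‖ := by
    rw [norm_mul, n1, Complex.norm_two]
    linarith [norm_nonneg l]
  have n4 : ‖l‖ ≤ ‖2 * -(Complex.I * l)‖ := by
    rw [norm_mul, n2, Complex.norm_two]
    linarith [norm_nonneg l]
  obtain ⟨m₁, hm₁⟩ := isCompact_Icc.exists_isMaxOn (nonempty_Icc.2 Real.pi_pos.le)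
    hs.fst.continuousOn.norm
  obtain ⟨m₂, hm₂⟩ := isCompact_Icc.exists_isMaxOn (nonempty_Icc.2 Real.pi_pos.le)
    hs.snd.continuousOn.norm
  set m := max ‖y₁ m₁‖ ‖y₂ m₂‖
  have hm0 : 0 ≤ m := (norm_nonneg _).trans (le_max_left _ _)
  have hy₁ : ∀ x ∈ Icc 0 Real.pi, ‖y₁ x‖ ≤ m := fun x hx => (hm₁.2 hx).trans (le_max_left _ _)
  have hy₂ : ∀ x ∈ Icc 0 Real.pi, ‖y₂ x‖ ≤ m := fun x hx => (hm₂.2 hx).trans (le_max_right _ _)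
  have ih₁ : IntegrableOn (fun t => q₁ t * y₂ t + g₁ t) (Icc 0 Real.pi) :=
    (hq₁.mul_continuousOn hs.snd.continuousOn isCompact_Icc).add hg₁
  have ih₂ : IntegrableOn (fun t => q₂ t * y₁ t + g₂ t) (Icc 0 Real.pi) :=
    (hq₂.mul_continuousOn hs.fst.continuousOn isCompact_Icc).add hg₂
  set e := η * (m + (m * Q + G)) + η with he
  have hn₁ := normL1_mul_add_le hq₁ hg₁ hy₂
  have hn₂ := normL1_mul_add_le hq₂ hg₂ hy₁
  have hmq₁ : 0 ≤ m * normL1 q₁ := by positivity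
  have hmq₂ : 0 ≤ m * normL1 q₂ := by positivity
  -- For `Im l ≤ 0` the stable direction for `y₁` is backwards from `π`, and for `y₂` forwards from
  -- `0`.
  have d₁ : ∀ x ∈ Icc 0 Real.pi,
      ‖y₁ x - Complex.exp (-(Complex.I * l) * (Real.pi - x)) * y₁ Real.pi‖ ≤ e := by
    intro x hx
    have hre : ∀ t ∈ Icc 0 Real.pi, (-(Complex.I * l)).re * (Real.pi - t) ≤ 0 := by
      intro t ht
      simp only [Complex.neg_re, Complex.mul_re, Complex.I_re, Complex.I_im]
      nlinarith [ht.2]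
    have h1 := norm_sub_exp_mul_le hq₁ hg₁ ih₂ (ν := -(Complex.I * l))
      (hs.fst.congr fun t => by ring) hs.snd hx right_mem (hre x hx)
      (fun t ht => hR₁ _ (hl₁.trans n4) t (uIcc_subset_seg hx right_mem ht) _ right_mem (by
        have := hre t (uIcc_subset_seg hx right_mem ht)
        simp only [Complex.mul_re, Complex.re_ofNat, Complex.im_ofNat] at this ⊢
        linarith))
      (hR₃ _ (hl₃.trans n2.ge) x hx _ right_mem (hre x hx)) (hy₂ x hx)
    refine h1.trans ?_
    rw [he]
    gcongr
    rw [hQ, mul_add]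
    linarith
  have d₂ : ∀ x ∈ Icc 0 Real.pi,
      ‖y₂ x - Complex.exp (Complex.I * l * ((0 : ℝ) - x)) * y₂ 0‖ ≤ e := by
    intro x hx
    have hre : ∀ t ∈ Icc 0 Real.pi, (Complex.I * l).re * (0 - t) ≤ 0 := by
      intro t ht
      simp only [Complex.mul_re, Complex.I_re, Complex.I_im]
      nlinarith [ht.1]
    have h1 := norm_sub_exp_mul_le hq₂ hg₂ ih₁ (ν := Complex.I * l)
      hs.snd hs.fst hx left_mem (hre x hx)
      (fun t ht => hR₂ _ (hl₂.trans n3) t (uIcc_subset_seg hx left_mem ht) _ left_mem (by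
        have := hre t (uIcc_subset_seg hx left_mem ht)
        simp only [Complex.mul_re, Complex.re_ofNat, Complex.im_ofNat] at this ⊢
        linarith))
      (hR₄ _ (hl₄.trans n1.ge) x hx _ left_mem (hre x hx)) (hy₁ x hx)
    refine h1.trans ?_
    rw [he]
    gcongr
    rw [hQ, mul_add]
    linarith
  have hw : ∀ t ∈ Icc 0 Real.pi, ‖Complex.exp (-(Complex.I * l) * t)‖ ≤ 1 := by
    intro t ht
    rw [Complex.norm_exp]
    refine Real.exp_le_one_iff.2 ?_
    simp only [Complex.neg_re, Complex.mul_re, Complex.I_re, Complex.I_im, Complex.neg_im,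
      Complex.ofReal_re, Complex.ofReal_im, Complex.mul_im]
    nlinarith [ht.1]
  -- At the opposite endpoints, `y₁ 0` and `y₂ π` are `e^{-iπl}` times `y₁ π` and `y₂ 0` up to `e`,
  -- so the boundary conditions become a nearly homogeneous system for the latter two values.
  have b₁ := d₁ 0 left_mem
  have b₂ := d₂ Real.pi right_mem
  have e₁ : -(Complex.I * l) * ((Real.pi : ℂ) - (0 : ℝ)) = -(Complex.I * l) * Real.pi := by simp
  have e₂ : Complex.I * l * (((0 : ℝ) : ℂ) - Real.pi) = -(Complex.I * l) * Real.pi := by simp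
  rw [e₁] at b₁
  rw [e₂] at b₂
  obtain ⟨ha, hb⟩ := norm_le_of_charPoly hK hδ (hw _ right_mem) hc b₁ b₂ hbc
  have c₁ : ‖y₁ m₁‖ ≤ Λ * e := by
    have h1 := d₁ m₁ hm₁.1
    have h2 := hw (Real.pi - m₁) ⟨by linarith [hm₁.1.2], by linarith [hm₁.1.1]⟩
    push_cast at h2
    have h3 := norm_sub_norm_le (y₁ m₁)
      (Complex.exp (-(Complex.I * l) * (Real.pi - m₁)) * y₁ Real.pi)
    rw [norm_mul] at h3
    have h4 := mul_le_of_le_one_left (norm_nonneg (y₁ Real.pi)) h2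
    rw [hΛ, add_mul, one_mul]
    linarith
  have c₂ : ‖y₂ m₂‖ ≤ Λ * e := by
    have h1 := d₂ m₂ hm₂.1
    have h2 := hw m₂ hm₂.1
    have e₃ : Complex.I * l * (((0 : ℝ) : ℂ) - m₂) = -(Complex.I * l) * m₂ := by simp
    rw [e₃] at h1
    have h3 := norm_sub_norm_le (y₂ m₂) (Complex.exp (-(Complex.I * l) * m₂) * y₂ 0)
    rw [norm_mul] at h3
    have h4 := mul_le_of_le_one_left (norm_nonneg (y₂ 0)) h2
    rw [hΛ, add_mul, one_mul]
    linarith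
  have hmb : m ≤ Λ * e := max_le c₁ c₂
  have hmε : m ≤ ε := by
    have := mul_le_mul_of_nonneg_right hη1 hm0
    linarith
  exact fun x hx => ⟨(hy₁ x hx).trans hmε, (hy₂ x hx).trans hmε⟩

/-- The permutation of the columns of `U` which corresponds to interchanging `y₁` and `y₂`. -/
def swapCols (U : Matrix (Fin 2) (Fin 4) ℂ) : Matrix (Fin 2) (Fin 4) ℂ :=
  U.submatrix id ![1, 0, 3, 2]

/-- The a priori estimate in the closed upper half-plane. -/
theorem apriori_upper {q₁ q₂ g₁ g₂ : ℝ → ℂ} (hq₁ : IntegrableOn q₁ (Icc 0 Real.pi))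
    (hq₂ : IntegrableOn q₂ (Icc 0 Real.pi)) (hg₁ : IntegrableOn g₁ (Icc 0 Real.pi))
    (hg₂ : IntegrableOn g₂ (Icc 0 Real.pi)) (U : Matrix (Fin 2) (Fin 4) ℂ) {δ ε : ℝ}
    (hδ : 0 < δ) (hε : 0 < ε) :
    ∃ R, ∀ l : ℂ, 0 ≤ l.im → R ≤ ‖l‖ →
      δ ≤ ‖charPoly (swapCols U) (Complex.exp (Complex.I * l * Real.pi))‖ →
      ∀ y₁ y₂ : ℝ → ℂ, IsSol q₁ q₂ g₁ g₂ l y₁ y₂ → BCond U y₁ y₂ →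
        ∀ x ∈ Icc 0 Real.pi, ‖y₁ x‖ ≤ ε ∧ ‖y₂ x‖ ≤ ε := by
  obtain ⟨R, hR⟩ := apriori_lower hq₂ hq₁ hg₂ hg₁ (swapCols U) hδ hε
  refine ⟨R, fun l hl hRl hc y₁ y₂ hs hbc x hx => ?_⟩
  have e : -(Complex.I * -l) = Complex.I * l := by ring
  refine (hR (-l) (by simpa using hl) (by simpa using hRl) (by rwa [e]) y₂ y₁ hs.swap
    (fun i => ?_) x hx).symm
  have := hbc i
  simp only [swapCols, Matrix.submatrix_apply, id, Matrix.cons_val]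
  linear_combination this

/-! ### Cancellation of poles for an affine operator pencil -/

section Pencil

variable {Z W : Type*} [NormedAddCommGroup Z] [NormedSpace ℂ Z] [NormedAddCommGroup W]
  [NormedSpace ℂ W]

/-- If `N` solves `(A - λ S) N(λ) = O((λ - l)^m)` near `l`, then a functional which vanishes on
all chains of root vectors of the pencil at `l` vanishes on `N(λ)` to order `m`. -/
theorem exists_factor_of_pencil (A S : Z →L[ℂ] W) (Φ : Z →L[ℂ] ℂ) (K : Set Z) (l : ℂ)
    (hK : ∀ v ∈ K, ∀ z, A z - l • S z = S v → z ∈ K) (hΦ : ∀ v ∈ K, Φ v = 0) (m : ℕ) :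
    ∀ (N : ℂ → Z) (v : Z) (g : ℂ → W), AnalyticAt ℂ N l → v ∈ K → ContinuousAt g l →
      (∀ᶠ s in 𝓝 l, A (N s) - s • S (N s) = S v + (s - l) ^ m • g s) →
      ∃ F : ℂ → ℂ, AnalyticAt ℂ F l ∧ ∀ᶠ s in 𝓝 l, Φ (N s) = (s - l) ^ m * F s := by
  induction m with
  | zero =>
    intro N v g hN _ _ _
    exact ⟨fun s => Φ (N s), Φ.analyticAt _ |>.comp hN, by simp⟩
  | succ m ih =>
    intro N v g hN hv hg h
    -- For a positive exponent the equation at `s = l` says that `N l` is the next vector of the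
    -- chain after `v`.
    have h0 : N l ∈ K := hK v hv (N l) (by simpa using h.self_of_nhds)
    obtain ⟨p, hp⟩ := hN
    have hD : AnalyticAt ℂ (dslope N l) l := ⟨_, hp.has_fpower_series_dslope_fslope⟩
    have hN' : ∀ s, N s = N l + (s - l) • dslope N l s := fun s => by
      rw [sub_smul_dslope]
      abel
    -- Substituting `N s = N l + (s - l) • dslope N l s` and dividing by `s - l` leaves the same
    -- equation for the slope, with `N l` in place of `v` and exponent `m`. The division is valid
    -- for `s ≠ l`; continuity of both sides, hence of `g`, covers `s = l`.
    obtain ⟨F, hF, hF'⟩ := ih (dslope N l) (N l) g hD h0 hg (by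
      have hc1 : ContinuousAt (fun s => A (dslope N l s) - s • S (dslope N l s)) l :=
        (A.continuous.continuousAt.comp hD.continuousAt).sub
          (continuousAt_id.smul (S.continuous.continuousAt.comp hD.continuousAt))
      have hc2 : ContinuousAt (fun s => S (N l) + (s - l) ^ m • g s) l :=
        continuousAt_const.add (ContinuousAt.smul (by fun_prop) hg)
      refine (hc1.eventuallyEq_nhds_iff_eventuallyEq_nhdsNE hc2).1 ?_
      filter_upwards [nhdsWithin_le_nhds h, self_mem_nhdsWithin] with s hs hne
      have hne' : s - l ≠ 0 := sub_ne_zero.2 hne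
      have hl : A (N l) - l • S (N l) = S v := by simpa using h.self_of_nhds
      refine smul_right_injective W hne' ?_
      simp only
      rw [hN' s] at hs
      simp only [map_add, map_smul] at hs
      have e : A (N l) = S v + l • S (N l) := by rw [← hl]; abel
      rw [e] at hs
      have hs' : (s - l) • A (dslope N l s) - s • (s - l) • S (dslope N l s) =
          (s - l) • S (N l) + (s - l) ^ (m + 1) • g s := by
        have := congrArg (fun t => t - S v - l • S (N l) + s • S (N l)) hs
        simp only [smul_add] at this
        rw [sub_smul (M := W) s l (S (N l))]
        have e1 : ∀ a b c d f : W, a + b + c - (d + f) - a - b + d = c - f := by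
          intros; abel
        have e2 : ∀ a b c d : W, a + b - a - c + d = d - c + b := by
          intros; abel
        rw [e1, e2] at this
        exact this
      rw [smul_sub, smul_add, smul_comm (s - l) s, hs', pow_succ', mul_smul])
    refine ⟨F, hF, ?_⟩
    filter_upwards [hF'] with s hs
    rw [hN' s, map_add, map_smul, hΦ _ h0, hs, zero_add, smul_eq_mul, pow_succ']
    ring

/-- At a zero of `D` of order `m` the right-hand side is `O((s - l)^m)`, so the previous result with
`v = 0` makes `Φ ∘ N` vanish to order `m` as well: every zero of `D` is cancelled. -/
theorem exists_entire_quotient (A S : Z →L[ℂ] W) (Φ : Z →L[ℂ] ℂ) (K : ℂ → Set Z)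
    (hK0 : ∀ l, (0 : Z) ∈ K l)
    (hK : ∀ l, ∀ v ∈ K l, ∀ z, A z - l • S z = S v → z ∈ K l) (hΦ : ∀ l, ∀ v ∈ K l, Φ v = 0)
    {N : ℂ → Z} (hN : ∀ l, AnalyticAt ℂ N l) {D : ℂ → ℂ} (hD : Differentiable ℂ D)
    (hD0 : ∃ l, D l ≠ 0) (g : W) (hNg : ∀ l, A (N l) - l • S (N l) = D l • g) :
    ∃ F : ℂ → ℂ, Differentiable ℂ F ∧ ∀ l, Φ (N l) = D l * F l := by
  have hDa : ∀ l, AnalyticAt ℂ D l := fun l => hD.analyticAt l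
  have hne : ∀ l, ¬∀ᶠ s in 𝓝 l, D s = 0 := by
    intro l h
    obtain ⟨s, hs⟩ := hD0
    have : D = fun _ => 0 := AnalyticOnNhd.eq_of_eventuallyEq (z₀ := l)
      (fun z _ => hDa z) (fun z _ => analyticAt_const) h
    exact hs (by rw [this])
  have hloc : ∀ l, ∃ F : ℂ → ℂ, AnalyticAt ℂ F l ∧ ∀ᶠ s in 𝓝 l, Φ (N s) = D s * F s := by
    intro l
    obtain ⟨m, d, hd, hd0, hdm⟩ := (hDa l).exists_eventuallyEq_pow_smul_nonzero_iff.2 (hne l)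
    obtain ⟨F, hF, hF'⟩ := exists_factor_of_pencil A S Φ (K l) l (hK l) (hΦ l) m N 0
      (fun s => d s • g) (hN l) (hK0 l) (hd.continuousAt.smul continuousAt_const) (by
        filter_upwards [hdm] with s hs
        rw [hNg, hs, map_zero, zero_add, smul_eq_mul, mul_smul])
    refine ⟨fun s => F s / d s, hF.div hd hd0, ?_⟩
    filter_upwards [hF', hdm, hd.continuousAt.eventually_ne hd0] with s h1 h2 h3
    rw [h1, h2, smul_eq_mul]
    field_simp
  choose F hF hFe using hloc
  -- The local quotients agree wherever `D ≠ 0`, hence on a punctured neighbourhood of each point,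
  -- so their diagonal values glue to one entire function.
  refine ⟨fun l => F l l, fun l => ?_, fun l => (hFe l).self_of_nhds⟩
  refine (hF l).differentiableAt.congr_of_eventuallyEq ?_
  have h1 : ∀ᶠ s in 𝓝[≠] l, D s ≠ 0 := by
    rcases (hDa l).eventually_eq_zero_or_eventually_ne_zero with h | h
    · exact absurd h (hne l)
    · exact h
  rw [eventually_nhdsWithin_iff] at h1
  filter_upwards [hFe l, h1] with s h2 h3
  by_cases hs : s = l
  · rw [hs]
  · have h4 := (hFe s).self_of_nhds
    rw [h2] at h4
    exact (mul_left_cancel₀ (h3 hs) h4).symm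

end Pencil

/-! ### Growing rectangles and lower bounds from regularity -/

/-- An entire function which tends to zero along the sides of growing rectangles vanishes. -/
theorem eq_zero_of_small_on_rectangles {F : ℂ → ℂ} (hF : Differentiable ℂ F) (x₀ M : ℝ)
    (h : ∀ ε > 0, ∃ R, ∀ l : ℂ, R ≤ ‖l‖ → (M ≤ |l.im| ∨ ∃ n : ℤ, l.re = x₀ + 2 * n) →
      ‖F l‖ ≤ ε) (l : ℂ) : F l = 0 := by
  refine norm_le_zero_iff.1 (le_of_forall_pos_le_add fun ε hε => ?_)
  rw [zero_add]
  obtain ⟨R, hR⟩ := h ε hε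
  obtain ⟨n, hn⟩ := exists_nat_gt (|x₀| + |R| + |M| + ‖l‖)
  have hx := neg_abs_le x₀
  have hx' := le_abs_self x₀
  have hR' := le_abs_self R
  have hM' := le_abs_self M
  have hl0 := norm_nonneg l
  have hR0 := abs_nonneg R
  have hM0 := abs_nonneg M
  have hre := abs_le.1 (Complex.abs_re_le_norm l)
  have him := abs_le.1 (Complex.abs_im_le_norm l)
  set B : Set ℂ := Ioo (x₀ - 2 * n) (x₀ + 2 * n) ×ℂ Ioo (-(n : ℝ)) n with hB
  have hlB : l ∈ B := by
    rw [hB, Complex.mem_reProdIm]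
    exact ⟨⟨by linarith, by linarith⟩, by linarith, by linarith⟩
  have hbd : Bornology.IsBounded B := (Metric.isBounded_Ioo _ _).reProdIm (Metric.isBounded_Ioo _ _)
  refine Complex.norm_le_of_forall_mem_frontier_norm_le hbd hF.diffContOnCl ?_ (subset_closure hlB)
  intro z hz
  rw [hB, Complex.frontier_reProdIm, frontier_Ioo (by linarith), frontier_Ioo (by linarith),
    closure_Ioo (by linarith), closure_Ioo (by linarith)] at hz
  have hzr := Complex.abs_re_le_norm z
  have hzi := Complex.abs_im_le_norm z
  rcases hz with hz | hz
  · have h2 := (Complex.mem_reProdIm.1 hz).2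
    have h3 : |z.im| = n := by
      rcases h2 with h2 | h2
      · rw [h2, abs_neg, Nat.abs_cast]
      · rw [mem_singleton_iff.1 h2, Nat.abs_cast]
    exact hR z (by linarith) (Or.inl (by linarith))
  · have h2 := (Complex.mem_reProdIm.1 hz).1
    rcases h2 with h2 | h2
    · have h4 := neg_abs_le z.re
      refine hR z (by linarith) (Or.inr ⟨-n, ?_⟩)
      push_cast
      linarith
    · rw [mem_singleton_iff] at h2
      have h4 := le_abs_self z.re
      refine hR z (by linarith) (Or.inr ⟨n, ?_⟩)
      push_cast
      linarith

theorem continuous_charPoly (U : Matrix (Fin 2) (Fin 4) ℂ) : Continuous (charPoly U) := by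
  unfold charPoly
  fun_prop

/-- `w = 0` is the limit of `e^{-iπl}` as `Im l → -∞`. This and `charPoly_swapCols_zero` are where
the two factors of the regularity condition enter, one for each half-plane. -/
theorem charPoly_zero (U : Matrix (Fin 2) (Fin 4) ℂ) : charPoly U 0 = -minorJ U 1 2 := by
  simp [charPoly, minorJ, Matrix.det_fin_two]
  ring

theorem charPoly_swapCols_zero (U : Matrix (Fin 2) (Fin 4) ℂ) :
    charPoly (swapCols U) 0 = -minorJ U 0 3 := by
  simp [charPoly, minorJ, swapCols, Matrix.det_fin_two]
  ring

/-- Thanks to this reflection, one vertical line avoids the zeros in both half-planes. -/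
theorem charPoly_swapCols (U : Matrix (Fin 2) (Fin 4) ℂ) {w : ℂ} (hw : w ≠ 0) :
    charPoly (swapCols U) w = -(w ^ 2 * charPoly U w⁻¹) := by
  simp only [charPoly, swapCols, Matrix.submatrix_apply, id, Matrix.cons_val]
  field_simp
  ring

theorem finite_charPoly_roots {U : Matrix (Fin 2) (Fin 4) ℂ} (hU : minorJ U 1 2 ≠ 0) :
    {w | charPoly U w = 0}.Finite := by
  set p : Polynomial ℂ := (Polynomial.C (U 0 2) + Polynomial.X * Polynomial.C (U 0 0)) *
      (Polynomial.C (U 1 1) + Polynomial.X * Polynomial.C (U 1 3)) -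
    (Polynomial.C (U 1 2) + Polynomial.X * Polynomial.C (U 1 0)) *
      (Polynomial.C (U 0 1) + Polynomial.X * Polynomial.C (U 0 3)) with hp
  have hev : ∀ w, p.eval w = charPoly U w := fun w => by
    simp [hp, charPoly]
    ring
  have hp0 : p ≠ 0 := by
    intro h
    have := hev 0
    rw [h, Polynomial.eval_zero, charPoly_zero] at this
    exact hU (neg_eq_zero.1 this.symm)
  refine (p.rootSet_finite ℂ).subset fun w hw => ?_
  rw [Polynomial.mem_rootSet]
  exact ⟨hp0, by simpa [hev] using hw⟩

/-- There are vertical lines on which the characteristic polynomial is bounded away from zero. -/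
theorem exists_good_lines {U : Matrix (Fin 2) (Fin 4) ℂ} (hU : IsRegularBC U) :
    ∃ x₀ M δ : ℝ, 0 < δ ∧ ∀ l : ℂ, (M ≤ |l.im| ∨ ∃ n : ℤ, l.re = x₀ + 2 * n) →
      (l.im ≤ 0 → δ ≤ ‖charPoly U (Complex.exp (-(Complex.I * l) * Real.pi))‖) ∧
      (0 ≤ l.im → δ ≤ ‖charPoly (swapCols U) (Complex.exp (Complex.I * l * Real.pi))‖) := by
  have hJ2 : minorJ U 1 2 ≠ 0 := right_ne_zero_of_mul hU
  have hJ1 : minorJ U 0 3 ≠ 0 := left_ne_zero_of_mul hU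
  -- A ray from the origin that meets no zero of the characteristic polynomial; only finitely many
  -- directions are excluded.
  obtain ⟨θ, hθ, hθ'⟩ := (Ioc_infinite (neg_lt_self Real.pi_pos)).exists_notMem_finite
    ((finite_charPoly_roots hJ2).image Complex.arg)
  have hray : ∀ r : ℝ, 0 < r → charPoly U (r * Complex.exp (θ * Complex.I)) ≠ 0 := by
    intro r hr h
    refine hθ' ⟨_, h, ?_⟩
    rw [Complex.arg_real_mul _ hr, Complex.arg_exp_mul_I, toIocMod_eq_self]
    exact ⟨hθ.1, by linarith [hθ.2]⟩
  -- The segment `[0, ξ]` serves the vertical lines, by compactness; a small disc about `0` serves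
  -- the points with large `|Im l|`.
  have hc : ∀ (V : Matrix (Fin 2) (Fin 4) ℂ) (ξ : ℂ), charPoly V 0 ≠ 0 →
      (∀ r : ℝ, 0 < r → charPoly V (r * ξ) ≠ 0) →
      ∃ δ r₀ : ℝ, 0 < δ ∧ 0 < r₀ ∧ (∀ r ∈ Icc (0 : ℝ) 1, δ ≤ ‖charPoly V (r * ξ)‖) ∧
        ∀ w, ‖w‖ < r₀ → δ ≤ ‖charPoly V w‖ := by
    intro V ξ h0 hr
    have hcont : Continuous fun r : ℝ => ‖charPoly V (r * ξ)‖ :=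
      ((continuous_charPoly V).comp (by fun_prop)).norm
    obtain ⟨s, hs, hmin⟩ := (isCompact_Icc (a := (0 : ℝ)) (b := 1)).exists_isMinOn
      (nonempty_Icc.2 zero_le_one) hcont.continuousOn
    have hs0 : 0 < ‖charPoly V (s * ξ)‖ := by
      rw [norm_pos_iff]
      rcases hs.1.eq_or_lt with h | h
      · rw [← h]
        simpa using h0
      · exact hr s h
    have h2 : ∀ᶠ w in 𝓝 (0 : ℂ), ‖charPoly V 0‖ / 2 < ‖charPoly V w‖ :=
      (continuous_charPoly V).norm.continuousAt.eventually
        (lt_mem_nhds (half_lt_self (norm_pos_iff.2 h0)))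
    obtain ⟨r₀, hr₀, h3⟩ := Metric.eventually_nhds_iff.1 h2
    refine ⟨min (‖charPoly V (s * ξ)‖) (‖charPoly V 0‖ / 2), r₀,
      lt_min hs0 (half_pos (norm_pos_iff.2 h0)), hr₀, fun r hr => (min_le_left _ _).trans (hmin hr),
      fun w hw => (min_le_right _ _).trans (h3 (by simpa using hw)).le⟩
  obtain ⟨δ₁, r₁, hδ₁, hr₁, ha₁, hb₁⟩ := hc U (Complex.exp (θ * Complex.I))
    (by rw [charPoly_zero]; exact neg_ne_zero.2 hJ2) hray
  obtain ⟨δ₂, r₂, hδ₂, hr₂, ha₂, hb₂⟩ := hc (swapCols U) (Complex.exp (-(θ * Complex.I)))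
    (by rw [charPoly_swapCols_zero]; exact neg_ne_zero.2 hJ1) (by
      intro r hr
      have hr' : (r : ℂ) ≠ 0 := by exact_mod_cast hr.ne'
      rw [charPoly_swapCols U (mul_ne_zero hr' (Complex.exp_ne_zero _))]
      refine neg_ne_zero.2 (mul_ne_zero (pow_ne_zero _ (mul_ne_zero hr' (Complex.exp_ne_zero _))) ?_)
      rw [mul_inv, ← Complex.exp_neg, neg_neg, ← Complex.ofReal_inv]
      exact hray _ (inv_pos.2 hr))
  obtain ⟨M, hM⟩ : ∃ M : ℝ, ∀ t, M ≤ t → Real.exp (-(t * Real.pi)) < min r₁ r₂ := by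
    have h1 : Tendsto (fun t : ℝ => Real.exp (-(t * Real.pi))) atTop (𝓝 0) :=
      Real.tendsto_exp_neg_atTop_nhds_zero.comp (tendsto_id.atTop_mul_const Real.pi_pos)
    exact eventually_atTop.1 (h1.eventually (gt_mem_nhds (lt_min hr₁ hr₂)))
  have hpi : (Real.pi : ℂ) ≠ 0 := by exact_mod_cast Real.pi_ne_zero
  -- With `Re l = -θ / π + 2n`, the number `e^{-iπl}` has direction `e^{iθ}`; the step `2` is the
  -- period of `e^{-iπl}`.
  refine ⟨-θ / Real.pi, M, min δ₁ δ₂, lt_min hδ₁ hδ₂, fun l hl => ⟨fun him => ?_, fun him => ?_⟩⟩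
  · refine (min_le_left _ _).trans ?_
    rcases hl with hl | ⟨n, hn⟩
    · refine hb₁ _ ?_
      rw [abs_of_nonpos him] at hl
      rw [Complex.norm_exp]
      have := hM _ hl
      have e : (-(Complex.I * l) * Real.pi).re = -(-l.im * Real.pi) := by simp
      rw [e]
      exact this.trans_le (min_le_left _ _)
    · have e : Complex.exp (-(Complex.I * l) * Real.pi) =
          (Real.exp (l.im * Real.pi) : ℝ) * Complex.exp (θ * Complex.I) := by
        rw [Complex.ofReal_exp, ← Complex.exp_add, ← mul_one (Complex.exp (_ + _)),
          ← Complex.exp_int_mul_two_pi_mul_I (-n), ← Complex.exp_add]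
        congr 1
        conv_lhs => rw [← Complex.re_add_im l, hn]
        push_cast
        field_simp
        linear_combination (-(l.im : ℂ)) * Real.pi * Complex.I_sq
      rw [e]
      refine ha₁ _ ⟨(Real.exp_pos _).le, Real.exp_le_one_iff.2 ?_⟩
      exact mul_nonpos_of_nonpos_of_nonneg him Real.pi_pos.le
  · refine (min_le_right _ _).trans ?_
    rcases hl with hl | ⟨n, hn⟩
    · refine hb₂ _ ?_
      rw [abs_of_nonneg him] at hl
      rw [Complex.norm_exp]
      have := hM _ hl
      have e : (Complex.I * l * Real.pi).re = -(l.im * Real.pi) := by simp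
      rw [e]
      exact this.trans_le (min_le_right _ _)
    · have e : Complex.exp (Complex.I * l * Real.pi) =
          (Real.exp (-(l.im * Real.pi)) : ℝ) * Complex.exp (-(θ * Complex.I)) := by
        rw [Complex.ofReal_exp, ← Complex.exp_add, ← mul_one (Complex.exp (_ + _)),
          ← Complex.exp_int_mul_two_pi_mul_I n, ← Complex.exp_add]
        congr 1
        conv_lhs => rw [← Complex.re_add_im l, hn]
        push_cast
        field_simp
        linear_combination (l.im : ℂ) * Real.pi * Complex.I_sq
      rw [e]
      refine ha₂ _ ⟨(Real.exp_pos _).le, Real.exp_le_one_iff.2 ?_⟩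
      have := mul_nonneg him Real.pi_pos.le
      linarith

/-! ### Volterra equations on bounded continuous functions -/

/-- The projection of the line onto `[0, π]`. -/
def clip (x : ℝ) : ℝ := projIcc 0 Real.pi Real.pi_pos.le x

theorem continuous_clip : Continuous clip := continuous_subtype_val.comp continuous_projIcc

theorem clip_mem (x : ℝ) : clip x ∈ Icc 0 Real.pi := (projIcc 0 Real.pi Real.pi_pos.le x).2

theorem clip_of_mem {x : ℝ} (hx : x ∈ Icc 0 Real.pi) : clip x = x := by
  rw [clip, projIcc_of_mem _ hx]

theorem isPrimitive_integral {f : ℝ → ℂ} (hf : IntegrableOn f (Icc 0 Real.pi)) :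
    IsPrimitive (fun x => ∫ t in (0 : ℝ)..x, f t) f :=
  ⟨hf, fun x _ => by simp⟩

theorem integrableOn_mul_bcf {p : ℝ → ℂ} (hp : IntegrableOn p (Icc 0 Real.pi)) (y : ℝ →ᵇ ℂ) :
    IntegrableOn (fun t => p t * y t) (Icc 0 Real.pi) :=
  hp.mul_continuousOn y.continuous.continuousOn isCompact_Icc

theorem norm_integral_mul_bcf_le {p : ℝ → ℂ} (hp : IntegrableOn p (Icc 0 Real.pi)) (y : ℝ →ᵇ ℂ)
    (x : ℝ) : ‖∫ t in (0 : ℝ)..clip x, p t * y t‖ ≤ normL1 p * ‖y‖ := by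
  have := norm_integral_mul_le (g := y) hp left_mem (clip_mem x) fun t _ => y.norm_coe_le_norm t
  simpa only [mul_comm] using this

/-- The Volterra operator `y ↦ ∫₀ˣ p y` on bounded continuous functions on the line, the values
outside `[0, π]` being those at the nearest endpoint. -/
def volterra {p : ℝ → ℂ} (hp : IntegrableOn p (Icc 0 Real.pi)) : (ℝ →ᵇ ℂ) →L[ℂ] (ℝ →ᵇ ℂ) :=
  LinearMap.mkContinuous
    { toFun := fun y => BoundedContinuousFunction.ofNormedAddCommGroup
        (fun x => ∫ t in (0 : ℝ)..clip x, p t * y t)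
        ((isPrimitive_integral (integrableOn_mul_bcf hp y)).continuousOn.comp_continuous
          continuous_clip clip_mem)
        (normL1 p * ‖y‖) (norm_integral_mul_bcf_le hp y)
      map_add' := fun y z => by
        ext x
        simp only [BoundedContinuousFunction.coe_ofNormedAddCommGroup,
          BoundedContinuousFunction.coe_add, Pi.add_apply, mul_add]
        exact intervalIntegral.integral_add
          (intervalIntegrable_of_integrableOn (integrableOn_mul_bcf hp y) left_mem (clip_mem x))
          (intervalIntegrable_of_integrableOn (integrableOn_mul_bcf hp z) left_mem (clip_mem x))
      map_smul' := fun c y => by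
        ext x
        simp only [BoundedContinuousFunction.coe_ofNormedAddCommGroup,
          BoundedContinuousFunction.coe_smul, smul_eq_mul, RingHom.id_apply,
          ← intervalIntegral.integral_const_mul]
        exact intervalIntegral.integral_congr fun t _ => by ring }
    (normL1 p) (fun y => by
      refine (BoundedContinuousFunction.norm_le (mul_nonneg (normL1_nonneg p)
        (norm_nonneg y))).2 fun x => ?_
      exact norm_integral_mul_bcf_le hp y x)

theorem volterra_apply {p : ℝ → ℂ} (hp : IntegrableOn p (Icc 0 Real.pi)) (y : ℝ →ᵇ ℂ) (x : ℝ) :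
    volterra hp y x = ∫ t in (0 : ℝ)..clip x, p t * y t := rfl

/-- The function `x ↦ e^{ω x}` on `[0, π]`, extended by constants. -/
def expB (ω : ℝ) : ℝ →ᵇ ℂ :=
  BoundedContinuousFunction.ofNormedAddCommGroup (fun x => Complex.exp (ω * clip x))
    (by have := continuous_clip; fun_prop) (Real.exp (|ω| * Real.pi)) (fun x => by
      rw [Complex.norm_exp]
      refine Real.exp_le_exp.2 ?_
      have e : ((ω : ℂ) * clip x).re = ω * clip x := by simp
      rw [e]
      exact mul_le_mul (le_abs_self ω) (clip_mem x).2 (clip_mem x).1 (abs_nonneg ω))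

theorem expB_apply (ω x : ℝ) : expB ω x = Complex.exp (ω * clip x) := rfl

theorem expB_mul_expB_neg (ω : ℝ) : expB ω * expB (-ω) = 1 := by
  ext x
  simp only [BoundedContinuousFunction.coe_mul, Pi.mul_apply, expB_apply,
    BoundedContinuousFunction.coe_one, Pi.one_apply]
  rw [← Complex.exp_add]
  simp

/-- Conjugation by `e^{ωx}` gives the kernel `e^{ω(t-s)} p(t)` on `t ≤ s`. Its integral is
controlled by `riemann_lebesgue` for `|p|` at the real frequency `ω`, uniformly in `s`. -/
theorem exists_norm_volterra_conj_le {p : ℝ → ℂ} (hp : IntegrableOn p (Icc 0 Real.pi)) {η : ℝ}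
    (hη : 0 < η) : ∃ R, ∀ ω : ℝ, R ≤ ω → ∀ y : ℝ →ᵇ ℂ,
      ‖expB (-ω) * volterra hp (expB ω * y)‖ ≤ η * ‖y‖ := by
  obtain ⟨R, hR⟩ := riemann_lebesgue (p := fun t => (‖p t‖ : ℂ)) hp.norm.ofReal hη
  refine ⟨max R 0, fun ω hω y => ?_⟩
  have hω0 : 0 ≤ ω := (le_max_right _ _).trans hω
  refine (BoundedContinuousFunction.norm_le (by positivity)).2 fun x => ?_
  have hs := clip_mem x
  set s := clip x with hsx
  have e1 : (expB (-ω) * volterra hp (expB ω * y)) x =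
      ∫ t in (0 : ℝ)..s, Complex.exp (ω * (t - s)) * p t * y t := by
    simp only [BoundedContinuousFunction.coe_mul, Pi.mul_apply, expB_apply, volterra_apply]
    rw [← intervalIntegral.integral_const_mul]
    refine intervalIntegral.integral_congr fun t ht => ?_
    rw [uIcc_of_le hs.1] at ht
    have hct : clip t = t := clip_of_mem ⟨ht.1, ht.2.trans hs.2⟩
    have : Complex.exp (ω * (t - s)) = Complex.exp ((-ω : ℝ) * s) * Complex.exp (ω * t) := by
      rw [← Complex.exp_add]
      push_cast
      ring_nf
    simp only [this, hct, ← hsx]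
    ring
  rw [e1]
  have hi : IntervalIntegrable (fun t : ℝ => Real.exp (ω * (t - s)) * ‖p t‖ * ‖y‖) volume 0 s := by
    refine (IntervalIntegrable.continuousOn_mul ?_ (by fun_prop)).mul_const _
    rw [intervalIntegrable_iff_integrableOn_Icc_of_le hs.1]
    exact (hp.mono_set (Icc_subset_Icc_right hs.2)).norm
  have h1 : ‖∫ t in (0 : ℝ)..s, Complex.exp (ω * (t - s)) * p t * y t‖ ≤
      ∫ t in (0 : ℝ)..s, Real.exp (ω * (t - s)) * ‖p t‖ * ‖y‖ := by
    refine intervalIntegral.norm_integral_le_of_norm_le hs.1 (Eventually.of_forall fun t _ => ?_) hi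
    rw [norm_mul, norm_mul, Complex.norm_exp]
    have e : ((ω : ℂ) * (t - s)).re = ω * (t - s) := by simp
    rw [e]
    gcongr
    exact y.norm_coe_le_norm t
  refine h1.trans ?_
  rw [intervalIntegral.integral_mul_const]
  refine mul_le_mul_of_nonneg_right ?_ (norm_nonneg y)
  have h2 := hR ω (by
    rw [Complex.norm_real, Real.norm_of_nonneg hω0]
    exact (le_max_left _ _).trans hω) s hs 0 left_mem (by
      simp only [Complex.ofReal_re, zero_sub]
      nlinarith [hs.1])
  rw [intervalIntegral.integral_symm, norm_neg] at h2
  have e2 : ∫ t in (0 : ℝ)..s, Complex.exp (ω * (t - s)) * (‖p t‖ : ℂ) =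
      ((∫ t in (0 : ℝ)..s, Real.exp (ω * (t - s)) * ‖p t‖ : ℝ) : ℂ) := by
    rw [← intervalIntegral.integral_ofReal]
    refine intervalIntegral.integral_congr fun t _ => ?_
    push_cast
    rfl
  rw [e2, Complex.norm_real] at h2
  exact (le_abs_self _).trans h2

/-- Pairs of bounded continuous functions on the line. -/
abbrev Pair : Type := (ℝ →ᵇ ℂ) × (ℝ →ᵇ ℂ)

/-- The system of Volterra operators with the four given coefficients. -/
def volterraSystem {a b c d : ℝ → ℂ} (ha : IntegrableOn a (Icc 0 Real.pi))
    (hb : IntegrableOn b (Icc 0 Real.pi)) (hc : IntegrableOn c (Icc 0 Real.pi))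
    (hd : IntegrableOn d (Icc 0 Real.pi)) : Pair →L[ℂ] Pair :=
  ((volterra ha).coprod (volterra hb)).prod ((volterra hc).coprod (volterra hd))

/-- The system is similar to an operator of norm at most `1 / 2`, so a Neumann series inverts it.
Each row adds two conjugated entries, hence the `1 / 4` for each. -/
theorem isUnit_one_sub_volterraSystem {a b c d : ℝ → ℂ} (ha : IntegrableOn a (Icc 0 Real.pi))
    (hb : IntegrableOn b (Icc 0 Real.pi)) (hc : IntegrableOn c (Icc 0 Real.pi))
    (hd : IntegrableOn d (Icc 0 Real.pi)) : IsUnit (1 - volterraSystem ha hb hc hd) := by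
  have h4 : (0 : ℝ) < 1 / 4 := by norm_num
  obtain ⟨R₁, h₁⟩ := exists_norm_volterra_conj_le ha h4
  obtain ⟨R₂, h₂⟩ := exists_norm_volterra_conj_le hb h4
  obtain ⟨R₃, h₃⟩ := exists_norm_volterra_conj_le hc h4
  obtain ⟨R₄, h₄⟩ := exists_norm_volterra_conj_le hd h4
  set ω := max (max R₁ R₂) (max R₃ R₄)
  replace h₁ := h₁ ω ((le_max_left _ _).trans (le_max_left _ _))
  replace h₂ := h₂ ω ((le_max_right _ _).trans (le_max_left _ _))
  replace h₃ := h₃ ω ((le_max_left _ _).trans (le_max_right _ _))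
  replace h₄ := h₄ ω ((le_max_right _ _).trans (le_max_right _ _))
  let E : ℝ → (Pair →L[ℂ] Pair) := fun r =>
    (ContinuousLinearMap.mul ℂ (ℝ →ᵇ ℂ) (expB r)).prodMap
      (ContinuousLinearMap.mul ℂ (ℝ →ᵇ ℂ) (expB r))
  have hE : ∀ r z, E r z = (expB r * z.1, expB r * z.2) := fun r z => rfl
  have hEE : ∀ r, E r * E (-r) = 1 := by
    intro r
    refine ContinuousLinearMap.ext fun z => ?_
    change E r (E (-r) z) = z
    rw [hE, hE]
    simp only [← mul_assoc, expB_mul_expB_neg, one_mul]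
  let u : (Pair →L[ℂ] Pair)ˣ := ⟨E ω, E (-ω), hEE ω, by simpa using hEE (-ω)⟩
  set T := volterraSystem ha hb hc hd
  have hn : ‖(↑u⁻¹ : Pair →L[ℂ] Pair) * T * u‖ ≤ 1 / 2 := by
    refine ContinuousLinearMap.opNorm_le_bound _ (by norm_num) fun z => ?_
    change ‖E (-ω) (T (E ω z))‖ ≤ _
    have hz₁ : ‖z.1‖ ≤ ‖z‖ := norm_fst_le z
    have hz₂ : ‖z.2‖ ≤ ‖z‖ := norm_snd_le z
    have e : E (-ω) (T (E ω z)) =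
        (expB (-ω) * volterra ha (expB ω * z.1) + expB (-ω) * volterra hb (expB ω * z.2),
          expB (-ω) * volterra hc (expB ω * z.1) + expB (-ω) * volterra hd (expB ω * z.2)) := by
      rw [← mul_add, ← mul_add]
      rfl
    rw [e]
    refine max_le ((norm_add_le _ _).trans ?_) ((norm_add_le _ _).trans ?_)
    · linarith [h₁ z.1, h₂ z.2]
    · linarith [h₃ z.1, h₄ z.2]
  have h1 : IsUnit (1 - (↑u⁻¹ : Pair →L[ℂ] Pair) * T * u) :=
    isUnit_one_sub_of_norm_lt_one (R := Pair →L[ℂ] Pair)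
      (x := (↑u⁻¹ : Pair →L[ℂ] Pair) * T * u) (hn.trans_lt (by norm_num))
  have e : (1 : Pair →L[ℂ] Pair) - T = u * (1 - (↑u⁻¹ : Pair →L[ℂ] Pair) * T * u) * ↑u⁻¹ := by
    simp [mul_sub, sub_mul, mul_assoc]
  rw [e]
  exact (u.isUnit.mul h1).mul u⁻¹.isUnit

theorem integrableOn_const_seg (c : ℂ) : IntegrableOn (fun _ : ℝ => c) (Icc 0 Real.pi) :=
  continuousOn_const.integrableOn_Icc

/-- Embedding of `ℂ²` as pairs of constant functions. -/
def constPair : ℂ × ℂ →L[ℂ] Pair :=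
  (ContinuousLinearMap.toSpanSingleton ℂ (1 : ℝ →ᵇ ℂ)).prodMap
    (ContinuousLinearMap.toSpanSingleton ℂ (1 : ℝ →ᵇ ℂ))

/-- The part of the integral operator which carries the spectral parameter. -/
def spectralOp : Pair →L[ℂ] Pair :=
  (volterra (integrableOn_const_seg Complex.I)).prodMap
    (volterra (integrableOn_const_seg (-Complex.I)))

/-- The pair of primitives of `g₁`, `g₂`. -/
def sourcePair {g₁ g₂ : ℝ → ℂ} (hg₁ : IntegrableOn g₁ (Icc 0 Real.pi))
    (hg₂ : IntegrableOn g₂ (Icc 0 Real.pi)) : Pair := (volterra hg₁ 1, volterra hg₂ 1)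

/-- The `i`-th boundary form. -/
def bform (U : Matrix (Fin 2) (Fin 4) ℂ) (i : Fin 2) : Pair →L[ℂ] ℂ :=
  ContinuousLinearMap.coprod
    (U i 0 • BoundedContinuousFunction.evalCLM ℂ (0 : ℝ) +
      U i 2 • BoundedContinuousFunction.evalCLM ℂ Real.pi)
    (U i 1 • BoundedContinuousFunction.evalCLM ℂ (0 : ℝ) +
      U i 3 • BoundedContinuousFunction.evalCLM ℂ Real.pi)

theorem bcond_of_bform {U : Matrix (Fin 2) (Fin 4) ℂ} {z : Pair} (h : ∀ i, bform U i z = 0) :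
    BCond U z.1 z.2 := by
  intro i
  have h1 : (U i 0 * z.1 0 + U i 2 * z.1 Real.pi) + (U i 1 * z.2 0 + U i 3 * z.2 Real.pi) = 0 :=
    h i
  linear_combination h1

section

variable {q₁ q₂ : ℝ → ℂ} (hq₁ : IntegrableOn q₁ (Icc 0 Real.pi))
  (hq₂ : IntegrableOn q₂ (Icc 0 Real.pi))

/-- The part of the integral operator which carries the potential. -/
def potentialOp : Pair →L[ℂ] Pair :=
  ((volterra hq₁).comp (ContinuousLinearMap.snd ℂ _ _)).prod
    ((volterra hq₂).comp (ContinuousLinearMap.fst ℂ _ _))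

theorem isUnit_one_sub (l : ℂ) : IsUnit (1 - (potentialOp hq₁ hq₂ + l • spectralOp)) := by
  have e : potentialOp hq₁ hq₂ + l • spectralOp = volterraSystem
      (integrableOn_const_seg (l * Complex.I)) hq₁ hq₂
      (integrableOn_const_seg (l * -Complex.I)) := by
    refine ContinuousLinearMap.ext fun z => Prod.ext ?_ ?_
    · ext x
      change (∫ t in (0 : ℝ)..clip x, q₁ t * z.2 t) +
          l * (∫ t in (0 : ℝ)..clip x, Complex.I * z.1 t) =
        (∫ t in (0 : ℝ)..clip x, l * Complex.I * z.1 t) + ∫ t in (0 : ℝ)..clip x, q₁ t * z.2 t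
      simp only [intervalIntegral.integral_const_mul]
      ring
    · ext x
      change (∫ t in (0 : ℝ)..clip x, q₂ t * z.1 t) +
          l * (∫ t in (0 : ℝ)..clip x, -Complex.I * z.2 t) =
        (∫ t in (0 : ℝ)..clip x, q₂ t * z.1 t) + ∫ t in (0 : ℝ)..clip x, l * -Complex.I * z.2 t
      simp only [intervalIntegral.integral_const_mul]
      ring
  rw [e]
  exact isUnit_one_sub_volterraSystem _ _ _ _

theorem isSol_of_eq {l : ℂ} {z G : Pair} {c : ℂ × ℂ} {g₁ g₂ : ℝ → ℂ}
    (hg₁ : IntegrableOn g₁ (Icc 0 Real.pi)) (hg₂ : IntegrableOn g₂ (Icc 0 Real.pi))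
    (hG₁ : ∀ x, G.1 x = ∫ t in (0 : ℝ)..clip x, g₁ t)
    (hG₂ : ∀ x, G.2 x = ∫ t in (0 : ℝ)..clip x, g₂ t)
    (h : z - potentialOp hq₁ hq₂ z - l • spectralOp z = constPair c + G) :
    IsSol q₁ q₂ g₁ g₂ l z.1 z.2 ∧ z.1 0 = c.1 ∧ z.2 0 = c.2 := by
  have e₁ : ∀ x, z.1 x = (∫ t in (0 : ℝ)..clip x, q₁ t * z.2 t) +
      l * (∫ t in (0 : ℝ)..clip x, Complex.I * z.1 t) + c.1 + ∫ t in (0 : ℝ)..clip x, g₁ t := by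
    intro x
    have h1 : z.1 x - (∫ t in (0 : ℝ)..clip x, q₁ t * z.2 t) -
        l * (∫ t in (0 : ℝ)..clip x, Complex.I * z.1 t) = c.1 * 1 + G.1 x :=
      congrArg (fun w : Pair => w.1 x) h
    rw [← hG₁]
    linear_combination h1
  have e₂ : ∀ x, z.2 x = (∫ t in (0 : ℝ)..clip x, q₂ t * z.1 t) +
      l * (∫ t in (0 : ℝ)..clip x, -Complex.I * z.2 t) + c.2 + ∫ t in (0 : ℝ)..clip x, g₂ t := by
    intro x
    have h1 : z.2 x - (∫ t in (0 : ℝ)..clip x, q₂ t * z.1 t) -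
        l * (∫ t in (0 : ℝ)..clip x, -Complex.I * z.2 t) = c.2 * 1 + G.2 x :=
      congrArg (fun w : Pair => w.2 x) h
    rw [← hG₂]
    linear_combination h1
  have z₁ : z.1 0 = c.1 := by
    rw [e₁, clip_of_mem left_mem]
    simp
  have z₂ : z.2 0 = c.2 := by
    rw [e₂, clip_of_mem left_mem]
    simp
  have i₁ := integrableOn_mul_bcf hq₁ z.2
  have i₂ := integrableOn_mul_bcf hq₂ z.1
  have k₁ : IntegrableOn (fun t => q₁ t * z.2 t + g₁ t) (Icc 0 Real.pi) := i₁.add hg₁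
  have k₂ : IntegrableOn (fun t => q₂ t * z.1 t + g₂ t) (Icc 0 Real.pi) := i₂.add hg₂
  have j₁ := integrableOn_mul_bcf (integrableOn_const_seg (Complex.I * l)) z.1
  have j₂ := integrableOn_mul_bcf (integrableOn_const_seg (-(Complex.I * l))) z.2
  refine ⟨⟨⟨j₁.add k₁, fun x hx => ?_⟩, ⟨j₂.add k₂, fun x hx => ?_⟩⟩, z₁, z₂⟩
  · rw [intervalIntegral.integral_add (intervalIntegrable_of_integrableOn j₁ left_mem hx)
      (intervalIntegrable_of_integrableOn k₁ left_mem hx),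
      intervalIntegral.integral_add (intervalIntegrable_of_integrableOn i₁ left_mem hx)
      (intervalIntegrable_of_integrableOn hg₁ left_mem hx), z₁, e₁ x, clip_of_mem hx]
    simp only [intervalIntegral.integral_const_mul]
    ring
  · rw [intervalIntegral.integral_add (intervalIntegrable_of_integrableOn j₂ left_mem hx)
      (intervalIntegrable_of_integrableOn k₂ left_mem hx),
      intervalIntegral.integral_add (intervalIntegrable_of_integrableOn i₂ left_mem hx)
      (intervalIntegrable_of_integrableOn hg₂ left_mem hx), z₂, e₂ x, clip_of_mem hx]
    simp only [intervalIntegral.integral_const_mul]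
    ring

/-- The solution of the integral equation `y = T_λ y + G`. -/
def solve (G : Pair) (l : ℂ) : Pair :=
  Ring.inverse (1 - (potentialOp hq₁ hq₂ + l • spectralOp)) G

theorem solve_eq (G : Pair) (l : ℂ) : solve hq₁ hq₂ G l - potentialOp hq₁ hq₂ (solve hq₁ hq₂ G l) -
    l • spectralOp (solve hq₁ hq₂ G l) = G := by
  have h := Ring.mul_inverse_cancel _ (isUnit_one_sub hq₁ hq₂ l)
  have h1 := congrArg (fun T : Pair →L[ℂ] Pair => T G) h
  change _ = G at h1
  rw [sub_sub]
  exact h1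

/-- Inversion is differentiable at units, and the operator is affine in `l` and a unit for every
`l`. -/
theorem differentiable_solve (G : Pair) : Differentiable ℂ (solve hq₁ hq₂ G) := by
  intro l
  have h1 : DifferentiableAt ℂ
      (fun s : ℂ => (1 : Pair →L[ℂ] Pair) - (potentialOp hq₁ hq₂ + s • spectralOp)) l :=
    (differentiableAt_const _).sub
      ((differentiableAt_const _).add (differentiableAt_id.smul_const spectralOp))
  have h2 : DifferentiableAt ℂ (fun s : ℂ => Ring.inverse
      ((1 : Pair →L[ℂ] Pair) - (potentialOp hq₁ hq₂ + s • spectralOp))) l :=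
    DifferentiableAt.comp (g := (Ring.inverse : (Pair →L[ℂ] Pair) → (Pair →L[ℂ] Pair))) l
      (differentiableAt_inverse (R := Pair →L[ℂ] Pair) (isUnit_one_sub hq₁ hq₂ l)) h1
  exact h2.clm_apply (differentiableAt_const G)

/-! ### Characteristic determinant and the boundary value problem as a pencil -/

/-- The values of the boundary forms on the fundamental system of solutions. -/
def charMatrix (U : Matrix (Fin 2) (Fin 4) ℂ) (l : ℂ) : Matrix (Fin 2) (Fin 2) ℂ :=
  Matrix.of fun i j => bform U i (solve hq₁ hq₂ (constPair (if j = 0 then (1, 0) else (0, 1))) l)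

/-- The characteristic determinant. -/
def charDet (U : Matrix (Fin 2) (Fin 4) ℂ) (l : ℂ) : ℂ := (charMatrix hq₁ hq₂ U l).det

theorem differentiable_charMatrix (U : Matrix (Fin 2) (Fin 4) ℂ) (i j : Fin 2) :
    Differentiable ℂ fun l => charMatrix hq₁ hq₂ U l i j :=
  (bform U i).differentiable.comp (differentiable_solve hq₁ hq₂ _)

theorem charDet_eq (U : Matrix (Fin 2) (Fin 4) ℂ) (l : ℂ) : charDet hq₁ hq₂ U l =
    charMatrix hq₁ hq₂ U l 0 0 * charMatrix hq₁ hq₂ U l 1 1 -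
      charMatrix hq₁ hq₂ U l 0 1 * charMatrix hq₁ hq₂ U l 1 0 := by
  rw [charDet, Matrix.det_fin_two]

theorem differentiable_charDet (U : Matrix (Fin 2) (Fin 4) ℂ) :
    Differentiable ℂ (charDet hq₁ hq₂ U) := by
  have h := differentiable_charMatrix hq₁ hq₂ U
  have e : charDet hq₁ hq₂ U = fun l =>
      charMatrix hq₁ hq₂ U l 0 0 * charMatrix hq₁ hq₂ U l 1 1 -
      charMatrix hq₁ hq₂ U l 0 1 * charMatrix hq₁ hq₂ U l 1 0 := funext (charDet_eq hq₁ hq₂ U)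
  rw [e]
  exact ((h 0 0).mul (h 1 1)).sub ((h 0 1).mul (h 1 0))

theorem exists_homogeneous_of_charDet_eq_zero {U : Matrix (Fin 2) (Fin 4) ℂ} {l : ℂ}
    (h : charDet hq₁ hq₂ U l = 0) : ∃ z : Pair, IsSol q₁ q₂ (fun _ => 0) (fun _ => 0) l z.1 z.2 ∧
      BCond U z.1 z.2 ∧ (z.1 0 ≠ 0 ∨ z.2 0 ≠ 0) := by
  obtain ⟨v, hv, hv'⟩ := Matrix.exists_mulVec_eq_zero_iff.2 h
  set y₁ := solve hq₁ hq₂ (constPair (1, 0)) l with hy₁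
  set y₂ := solve hq₁ hq₂ (constPair (0, 1)) l with hy₂
  have e₁ := solve_eq hq₁ hq₂ (constPair (1, 0)) l
  have e₂ := solve_eq hq₁ hq₂ (constPair (0, 1)) l
  rw [← hy₁] at e₁
  rw [← hy₂] at e₂
  obtain ⟨hs, h1, h2⟩ := isSol_of_eq hq₁ hq₂ (l := l) (z := v 0 • y₁ + v 1 • y₂) (G := 0)
    (c := (v 0, v 1)) (integrableOn_const_seg 0) (integrableOn_const_seg 0)
    (fun x => by simp) (fun x => by simp) (by
      have ec : constPair (v 0, v 1) = v 0 • constPair (1, 0) + v 1 • constPair (0, 1) := by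
        rw [← map_smul, ← map_smul, ← map_add]
        simp
      rw [ec, add_zero, ← e₁, ← e₂, map_add, map_add, map_smul, map_smul, map_smul, map_smul]
      module)
  refine ⟨_, hs, bcond_of_bform fun i => ?_, ?_⟩
  · have h3 := congrFun hv' i
    simp only [Matrix.mulVec, dotProduct, Fin.sum_univ_two, charMatrix, Matrix.of_apply, if_pos,
      Pi.zero_apply, one_ne_zero, if_false] at h3
    rw [map_add, map_smul, map_smul, smul_eq_mul, smul_eq_mul, hy₁, hy₂]
    linear_combination h3
  · rw [h1, h2]
    by_contra hcon
    push Not at hcon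
    exact hv (by ext i; fin_cases i; exacts [hcon.1, hcon.2])

/-- The boundary value problem as an affine operator pencil `A - λ S`. -/
def pencilA (U : Matrix (Fin 2) (Fin 4) ℂ) : Pair × (ℂ × ℂ) →L[ℂ] Pair × (ℂ × ℂ) :=
  ContinuousLinearMap.prod
    (ContinuousLinearMap.fst ℂ _ _ - (potentialOp hq₁ hq₂).comp (ContinuousLinearMap.fst ℂ _ _) -
      constPair.comp (ContinuousLinearMap.snd ℂ _ _))
    (((bform U 0).prod (bform U 1)).comp (ContinuousLinearMap.fst ℂ _ _))

/-- The linear coefficient of the pencil of the boundary value problem. -/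
def pencilS : Pair × (ℂ × ℂ) →L[ℂ] Pair × (ℂ × ℂ) :=
  (spectralOp.comp (ContinuousLinearMap.fst ℂ _ _)).prod 0

/-- The initial value is carried as the additional unknown in `ℂ × ℂ`, balanced by the two boundary
forms in the target. This keeps the dependence on `l` affine. -/
theorem pencil_eq_iff (U : Matrix (Fin 2) (Fin 4) ℂ) (l : ℂ) (z : Pair × (ℂ × ℂ)) (G : Pair) :
    pencilA hq₁ hq₂ U z - l • pencilS z = (G, 0) ↔
      z.1 - potentialOp hq₁ hq₂ z.1 - l • spectralOp z.1 = constPair z.2 + G ∧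
        ∀ i, bform U i z.1 = 0 := by
  have e : pencilA hq₁ hq₂ U z - l • pencilS z =
      (z.1 - potentialOp hq₁ hq₂ z.1 - constPair z.2 - l • spectralOp z.1,
        (bform U 0 z.1 - l • 0, bform U 1 z.1 - l • 0)) := rfl
  rw [e, Prod.mk.injEq, smul_zero, sub_zero, sub_zero, Prod.mk_eq_zero, Fin.forall_fin_two]
  refine and_congr_left fun _ => ?_
  constructor
  · intro h
    rw [← h]
    abel
  · intro h
    rw [sub_right_comm, h]
    abel

/-- Cramer's rule before division: `a` and `b` are the numerators for the initial values that
correct the boundary forms of `charDet • y₀` to zero. Nothing is divided, so `N` is entire even at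
eigenvalues. -/
theorem exists_pencil_solution (U : Matrix (Fin 2) (Fin 4) ℂ) (G : Pair) :
    ∃ N : ℂ → Pair × (ℂ × ℂ), Differentiable ℂ N ∧
      ∀ l, pencilA hq₁ hq₂ U (N l) - l • pencilS (N l) = charDet hq₁ hq₂ U l • (G, 0) := by
  set M := charMatrix hq₁ hq₂ U with hM
  set y₁ := solve hq₁ hq₂ (constPair (1, 0)) with hy₁
  set y₂ := solve hq₁ hq₂ (constPair (0, 1)) with hy₂
  set y₀ := solve hq₁ hq₂ G with hy₀
  have hM0 : ∀ l i, bform U i (y₁ l) = M l i 0 := fun l i => rfl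
  have hM1 : ∀ l i, bform U i (y₂ l) = M l i 1 := fun l i => rfl
  have hMd := differentiable_charMatrix hq₁ hq₂ U
  have d₁ : Differentiable ℂ y₁ := differentiable_solve hq₁ hq₂ _
  have d₂ : Differentiable ℂ y₂ := differentiable_solve hq₁ hq₂ _
  have d₀ : Differentiable ℂ y₀ := differentiable_solve hq₁ hq₂ _
  have db : ∀ i, Differentiable ℂ fun l => bform U i (y₀ l) := fun i =>
    (bform U i).differentiable.comp d₀
  set a : ℂ → ℂ := fun l => M l 0 1 * bform U 1 (y₀ l) - M l 1 1 * bform U 0 (y₀ l) with ha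
  set b : ℂ → ℂ := fun l => M l 1 0 * bform U 0 (y₀ l) - M l 0 0 * bform U 1 (y₀ l) with hb
  have da : Differentiable ℂ a := ((hMd 0 1).mul (db 1)).sub ((hMd 1 1).mul (db 0))
  have db' : Differentiable ℂ b := ((hMd 1 0).mul (db 0)).sub ((hMd 0 0).mul (db 1))
  have dD := differentiable_charDet hq₁ hq₂ U
  refine ⟨fun l => (charDet hq₁ hq₂ U l • y₀ l + a l • y₁ l + b l • y₂ l, (a l, b l)),
    (((dD.smul d₀).add (da.smul d₁)).add (db'.smul d₂)).prodMk (da.prodMk db'), fun l => ?_⟩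
  have eG : charDet hq₁ hq₂ U l • ((G, 0) : Pair × (ℂ × ℂ)) = (charDet hq₁ hq₂ U l • G, 0) := by
    rw [Prod.smul_mk, smul_zero]
  rw [eG, pencil_eq_iff]
  have e₁ := solve_eq hq₁ hq₂ (constPair (1, 0)) l
  have e₂ := solve_eq hq₁ hq₂ (constPair (0, 1)) l
  have e₀ := solve_eq hq₁ hq₂ G l
  rw [← hy₁] at e₁
  rw [← hy₂] at e₂
  rw [← hy₀] at e₀
  constructor
  · have ec : constPair (a l, b l) = a l • constPair (1, 0) + b l • constPair (0, 1) := by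
      rw [← map_smul, ← map_smul, ← map_add]
      simp
    simp only
    rw [ec]
    conv_rhs => rw [← e₁, ← e₂, ← e₀]
    simp only [map_add, map_smul]
    module
  · intro i
    simp only [map_add, map_smul, hM0, hM1, smul_eq_mul, charDet_eq, ha, hb, ← hM]
    fin_cases i
    · simp only [Fin.zero_eta]
      ring
    · simp only [Fin.mk_one]
      ring

end

/-! ### Passage to the operator in `H` and to `L_α` -/

/-- The classes in `(L_α[0,π])²` of a pair of bounded continuous functions. -/
def pairToLp (α : ℝ≥0∞) [Fact (1 ≤ α)] : Pair →L[ℂ] LpPair α :=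
  ContinuousLinearMap.pi ![
    (BoundedContinuousFunction.toLp α segMeasure ℂ).comp (ContinuousLinearMap.fst ℂ _ _),
    (BoundedContinuousFunction.toLp α segMeasure ℂ).comp (ContinuousLinearMap.snd ℂ _ _)]

theorem coeFn_pairToLp (α : ℝ≥0∞) [Fact (1 ≤ α)] (z : Pair) (j : Fin 2) :
    (pairToLp α z j : ℝ → ℂ) =ᵐ[segMeasure] fun x => ![z.1 x, z.2 x] j := by
  fin_cases j
  · exact BoundedContinuousFunction.coeFn_toLp α segMeasure ℂ z.1
  · exact BoundedContinuousFunction.coeFn_toLp α segMeasure ℂ z.2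

theorem ae_segMeasure_of_forall {p : ℝ → Prop} (h : ∀ x ∈ Icc 0 Real.pi, p x) :
    ∀ᵐ x ∂segMeasure, p x :=
  (ae_restrict_iff' measurableSet_Icc).2 (Eventually.of_forall h)

theorem exists_norm_pairToLp_le (α : ℝ≥0∞) [Fact (1 ≤ α)] : ∃ C : ℝ, 0 < C ∧ ∀ (z : Pair) (ε : ℝ),
    0 ≤ ε → (∀ x ∈ Icc 0 Real.pi, ‖z.1 x‖ ≤ ε ∧ ‖z.2 x‖ ≤ ε) → ‖pairToLp α z‖ ≤ C * ε := by
  refine ⟨measureUnivNNReal segMeasure ^ α.toReal⁻¹ + 1, by positivity, fun z ε hε hz => ?_⟩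
  refine (pi_norm_le_iff_of_nonneg (by positivity)).2 fun j => ?_
  refine (Lp.norm_le_of_ae_bound (C := ε) hε ?_).trans (by rw [add_mul, one_mul]; linarith)
  filter_upwards [coeFn_pairToLp α z j, ae_segMeasure_of_forall hz] with x h1 h2
  rw [h1]
  fin_cases j
  exacts [h2.1, h2.2]

/-- The element of `H` given by a pair of bounded continuous functions. -/
def pairToH : Pair →ₗ[ℂ] H :=
  (WithLp.linearEquiv 2 ℂ (LpPair 2)).symm.toLinearMap ∘ₗ (pairToLp 2).toLinearMap

theorem coeFn_pairToH (z : Pair) (j : Fin 2) :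
    (pairToH z j : ℝ → ℂ) =ᵐ[segMeasure] fun x => ![z.1 x, z.2 x] j := coeFn_pairToLp 2 z j

theorem absolutelyContinuousOnInterval_vec {y₁ y₂ : ℝ → ℂ} {a b : ℝ}
    (h₁ : AbsolutelyContinuousOnInterval y₁ a b) (h₂ : AbsolutelyContinuousOnInterval y₂ a b) :
    AbsolutelyContinuousOnInterval (fun x => ![y₁ x, y₂ x]) a b := by
  have e₁ := h₁.smul (LipschitzWith.const (![1, 0] : Fin 2 →
    ℂ)).lipschitzOnWith.absolutelyContinuousOnInterval
  have e₂ := h₂.smul (LipschitzWith.const (![0, 1] : Fin 2 →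
    ℂ)).lipschitzOnWith.absolutelyContinuousOnInterval
  refine (e₁.add e₂).congr fun x _ => ?_
  ext j
  fin_cases j <;> simp

/-- The system is `ℓ_P(z) = l z + v` multiplied by `B⁻¹ = diag(i, -i)`. -/
theorem isRep_of_isSol {p₂ p₃ : ℝ → ℂ} {U : Matrix (Fin 2) (Fin 4) ℂ} {l : ℂ} {z v : Pair}
    (hs : IsSol (fun t => -Complex.I * p₂ t) (fun t => Complex.I * p₃ t)
      (fun t => Complex.I * v.1 t) (fun t => -Complex.I * v.2 t) l z.1 z.2)
    (hbc : BCond U z.1 z.2) :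
    IsRep (offDiag p₂ p₃) U (pairToH z) (l • pairToH z + pairToH v) (fun x => ![z.1 x, z.2 x]) where
  ac := absolutelyContinuousOnInterval_vec hs.fst.ac hs.snd.ac
  rep := coeFn_pairToH z
  bc := by
    ext i
    have := hbc i
    fin_cases i <;>
    · simp [boundaryForm] at this ⊢
      linear_combination this
  eqn j := by
    have d₁ := (ae_restrict_iff' (μ := volume) measurableSet_Icc).2 hs.fst.ae_hasDerivAt
    have d₂ := (ae_restrict_iff' (μ := volume) measurableSet_Icc).2 hs.snd.ae_hasDerivAt
    filter_upwards [coeFn_pairToH z j, coeFn_pairToH v j,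
      Lp.coeFn_add ((l • pairToH z) j) (pairToH v j), Lp.coeFn_smul l (pairToH z j), d₁, d₂]
      with x h1 h2 h3 h4 h5 h6
    have e : ((l • pairToH z + pairToH v) j : ℝ → ℂ) x =
        l * (pairToH z j : ℝ → ℂ) x + (pairToH v j : ℝ → ℂ) x := by
      refine h3.trans ?_
      rw [Pi.add_apply]
      congr 1
    rw [e, h1, h2]
    have hd : HasDerivAt (fun x => ![z.1 x, z.2 x])
        ![Complex.I * l * z.1 x + (-Complex.I * p₂ x * z.2 x + Complex.I * v.1 x),
          -(Complex.I * l) * z.2 x + (Complex.I * p₃ x * z.1 x + -Complex.I * v.2 x)] x := by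
      rw [hasDerivAt_pi, Fin.forall_fin_two]
      exact ⟨h5, h6⟩
    simp only [diracExpr, hd.deriv]
    fin_cases j
    · simp [matB, offDiag]
      linear_combination (l * z.1 x - p₂ x * z.2 x + v.1 x) * Complex.I_sq
    · simp [matB, offDiag]
      linear_combination (l * z.2 x - p₃ x * z.1 x + v.2 x) * Complex.I_sq

theorem exists_of_mem_diracGraph {P : ℝ → Matrix (Fin 2) (Fin 2) ℂ}
    {U : Matrix (Fin 2) (Fin 4) ℂ} {u f : H} (h : (u, f) ∈ diracGraph P U) :
    ∃ w : (diracOperator P U).domain, (w : H) = u ∧ diracOperator P U w = f := by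
  rw [← diracOperator_graph, LinearPMap.mem_graph_iff] at h
  exact h

/-- Zero and the root functions for `l`, as pairs of bounded continuous functions. -/
def rootPairs (p₂ p₃ : ℝ → ℂ) (U : Matrix (Fin 2) (Fin 4) ℂ) (l : ℂ) : Set (Pair × (ℂ × ℂ)) :=
  {w | pairToH w.1 = 0 ∨ IsRootFunction (diracOperator (offDiag p₂ p₃) U) l (pairToH w.1)}

/-- `spectralOp` integrates `B⁻¹ v`, so a chain step of the pencil is a chain step `(L - l) w = v`
of the operator. As `v` is bounded and continuous, `l w + v` lies in `H` and `w` in the domain. -/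
theorem rootPairs_chain {p₂ p₃ : ℝ → ℂ} {U : Matrix (Fin 2) (Fin 4) ℂ}
    (hq₁ : IntegrableOn (fun t => -Complex.I * p₂ t) (Icc 0 Real.pi))
    (hq₂ : IntegrableOn (fun t => Complex.I * p₃ t) (Icc 0 Real.pi)) {l : ℂ}
    {v w : Pair × (ℂ × ℂ)} (hv : v ∈ rootPairs p₂ p₃ U l)
    (h : pencilA hq₁ hq₂ U w - l • pencilS w = pencilS v) : w ∈ rootPairs p₂ p₃ U l := by
  have hS : pencilS v = (spectralOp v.1, 0) := rfl
  rw [hS, pencil_eq_iff] at h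
  obtain ⟨hs, -, -⟩ := isSol_of_eq hq₁ hq₂
    (integrableOn_mul_bcf (integrableOn_const_seg Complex.I) v.1.1)
    (integrableOn_mul_bcf (integrableOn_const_seg (-Complex.I)) v.1.2)
    (fun x => rfl) (fun x => rfl) h.1
  obtain ⟨u, hu, hu'⟩ := exists_of_mem_diracGraph (u := pairToH w.1)
    (f := l • pairToH w.1 + pairToH v.1) ⟨_, isRep_of_isSol hs (bcond_of_bform h.2)⟩
  by_cases hw : pairToH w.1 = 0
  · exact Or.inl hw
  · refine Or.inr ?_
    rw [← hu] at hw hu' ⊢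
    rcases hv with hv | hv
    · exact IsRootFunction.eigen u hw (by rw [hu', hv, add_zero])
    · exact IsRootFunction.assoc u _ hv hu'

theorem IsSol.smul {q₁ q₂ g₁ g₂ : ℝ → ℂ} {l : ℂ} {y₁ y₂ : ℝ → ℂ} (c : ℂ)
    (h : IsSol q₁ q₂ g₁ g₂ l y₁ y₂) : IsSol q₁ q₂ (fun t => c * g₁ t) (fun t => c * g₂ t) l
      (fun t => c * y₁ t) (fun t => c * y₂ t) := by
  have key : ∀ {y k : ℝ → ℂ}, IsPrimitive y k →
      IsPrimitive (fun t => c * y t) (fun t => c * k t) := fun hy =>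
    ⟨hy.integrableOn.const_mul c, fun x hx => by
      rw [hy.eq x hx, intervalIntegral.integral_const_mul, mul_add]⟩
  exact ⟨(key h.fst).congr fun t => by ring, (key h.snd).congr fun t => by ring⟩

theorem IsSol.sub {q₁ q₂ g₁ g₂ f₁ f₂ : ℝ → ℂ} {l : ℂ} {y₁ y₂ z₁ z₂ : ℝ → ℂ}
    (h : IsSol q₁ q₂ g₁ g₂ l y₁ y₂) (h' : IsSol q₁ q₂ f₁ f₂ l z₁ z₂) :
    IsSol q₁ q₂ (fun t => g₁ t - f₁ t) (fun t => g₂ t - f₂ t) l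
      (fun t => y₁ t - z₁ t) (fun t => y₂ t - z₂ t) := by
  have key : ∀ {y k z m : ℝ → ℂ}, IsPrimitive y k → IsPrimitive z m →
      IsPrimitive (fun t => y t - z t) (fun t => k t - m t) := fun hy hz =>
    ⟨hy.integrableOn.sub hz.integrableOn, fun x hx => by
      rw [hy.eq x hx, hz.eq x hx, intervalIntegral.integral_sub
        (hy.intervalIntegrable left_mem hx) (hz.intervalIntegrable left_mem hx)]
      ring⟩
  exact ⟨(key h.fst h'.fst).congr fun t => by ring, (key h.snd h'.snd).congr fun t => by ring⟩

/-! ### Functionals that annihilate the root functions -/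

theorem exists_apriori {U : Matrix (Fin 2) (Fin 4) ℂ} (hU : IsRegularBC U) :
    ∃ x₀ M : ℝ, ∀ q₁ q₂ g₁ g₂ : ℝ → ℂ, IntegrableOn q₁ (Icc 0 Real.pi) →
      IntegrableOn q₂ (Icc 0 Real.pi) → IntegrableOn g₁ (Icc 0 Real.pi) →
      IntegrableOn g₂ (Icc 0 Real.pi) → ∀ ε > 0, ∃ R, ∀ l : ℂ, R ≤ ‖l‖ →
        (M ≤ |l.im| ∨ ∃ n : ℤ, l.re = x₀ + 2 * n) → ∀ y₁ y₂ : ℝ → ℂ,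
        IsSol q₁ q₂ g₁ g₂ l y₁ y₂ → BCond U y₁ y₂ →
          ∀ x ∈ Icc 0 Real.pi, ‖y₁ x‖ ≤ ε ∧ ‖y₂ x‖ ≤ ε := by
  obtain ⟨x₀, M, δ, hδ, h⟩ := exists_good_lines hU
  refine ⟨x₀, M, fun q₁ q₂ g₁ g₂ hq₁ hq₂ hg₁ hg₂ ε hε => ?_⟩
  obtain ⟨R₁, h₁⟩ := apriori_lower hq₁ hq₂ hg₁ hg₂ U hδ hε
  obtain ⟨R₂, h₂⟩ := apriori_upper hq₁ hq₂ hg₁ hg₂ U hδ hε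
  refine ⟨max R₁ R₂, fun l hl hgood => ?_⟩
  rcases le_total l.im 0 with him | him
  · exact h₁ l him ((le_max_left _ _).trans hl) ((h l hgood).1 him)
  · exact h₂ l him ((le_max_right _ _).trans hl) ((h l hgood).2 him)

/-- A functional on `(L_α)²` that vanishes on the root functions vanishes on all absolutely
continuous pairs that satisfy the boundary conditions. -/
theorem dual_eq_zero_of_bcond {p₂ p₃ : ℝ → ℂ} (hp₂ : IntegrableOn p₂ (Icc 0 Real.pi))
    (hp₃ : IntegrableOn p₃ (Icc 0 Real.pi)) {U : Matrix (Fin 2) (Fin 4) ℂ} (hU : IsRegularBC U)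
    {α : ℝ≥0∞} [Fact (1 ≤ α)] (φ : LpPair α →L[ℂ] ℂ)
    (hφ : ∀ z u, IsRootFunction (diracOperator (offDiag p₂ p₃) U) z u → ∀ v : LpPair α,
      (∀ j, (v j : ℝ → ℂ) =ᵐ[segMeasure] (u j : ℝ → ℂ)) → φ v = 0)
    {y₁ y₂ h₁ h₂ : ℝ → ℂ} (hy₁ : IsPrimitive y₁ h₁) (hy₂ : IsPrimitive y₂ h₂)
    (hbc : BCond U y₁ y₂) (v : LpPair α)
    (hv : ∀ j, (v j : ℝ → ℂ) =ᵐ[segMeasure] fun x => ![y₁ x, y₂ x] j) : φ v = 0 := by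
  obtain ⟨x₀, M, hap⟩ := exists_apriori hU
  set q₁ : ℝ → ℂ := fun t => -Complex.I * p₂ t
  set q₂ : ℝ → ℂ := fun t => Complex.I * p₃ t
  have hq₁ : IntegrableOn q₁ (Icc 0 Real.pi) := hp₂.const_mul _
  have hq₂ : IntegrableOn q₂ (Icc 0 Real.pi) := hp₃.const_mul _
  have hz := integrableOn_const_seg 0
  obtain ⟨R₀, hR₀⟩ := hap q₁ q₂ _ _ hq₁ hq₂ hz hz 1 one_pos
  have huniq : ∀ l : ℂ, R₀ ≤ ‖l‖ → (M ≤ |l.im| ∨ ∃ n : ℤ, l.re = x₀ + 2 * n) →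
      ∀ z₁ z₂ : ℝ → ℂ, IsSol q₁ q₂ (fun _ => 0) (fun _ => 0) l z₁ z₂ → BCond U z₁ z₂ →
        ∀ x ∈ Icc 0 Real.pi, z₁ x = 0 ∧ z₂ x = 0 := by
    intro l hl hgood z₁ z₂ hs hb x hx
    -- Every multiple of a homogeneous solution obeys the same a priori bound `1`, so the solution
    -- is zero.
    have key : ∀ c : ℂ, ‖c‖ * ‖z₁ x‖ ≤ 1 ∧ ‖c‖ * ‖z₂ x‖ ≤ 1 := by
      intro c
      have h1 := hs.smul c
      simp only [mul_zero] at h1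
      have h2 := hR₀ l hl hgood _ _ h1 (fun i => by linear_combination c * hb i) x hx
      simpa only [norm_mul] using h2
    have key' : ∀ s : ℂ, (∀ c : ℂ, ‖c‖ * ‖s‖ ≤ 1) → s = 0 := by
      intro s hs
      by_contra hs0
      have h3 := hs (2 / s)
      rw [norm_div, Complex.norm_two, div_mul_cancel₀ _ (norm_ne_zero_iff.2 hs0)] at h3
      norm_num at h3
    exact ⟨key' _ fun c => (key c).1, key' _ fun c => (key c).2⟩
  have hD : ∀ l : ℂ, R₀ ≤ ‖l‖ → (M ≤ |l.im| ∨ ∃ n : ℤ, l.re = x₀ + 2 * n) →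
      charDet hq₁ hq₂ U l ≠ 0 := by
    intro l hl hgood h0
    obtain ⟨z, hs, hb, hne⟩ := exists_homogeneous_of_charDet_eq_zero hq₁ hq₂ h0
    have := huniq l hl hgood _ _ hs hb 0 left_mem
    exact hne.elim (fun h => h this.1) (fun h => h this.2)
  obtain ⟨l₀, hl₀, hg₀⟩ : ∃ l₀ : ℂ, R₀ ≤ ‖l₀‖ ∧ (M ≤ |l₀.im| ∨ ∃ n : ℤ, l₀.re = x₀ + 2 * n) := by
    refine ⟨((max R₀ M : ℝ) : ℂ) * Complex.I, ?_, Or.inl ?_⟩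
    · rw [norm_mul, Complex.norm_I, mul_one, Complex.norm_real]
      exact (le_max_left _ _).trans (le_abs_self _)
    · simpa using (le_max_right R₀ M).trans (le_abs_self _)
  -- The sources for which the given pair is itself the solution at `l₀`; they are only known to be
  -- integrable.
  set g₁ : ℝ → ℂ := fun t => h₁ t - Complex.I * l₀ * y₁ t - q₁ t * y₂ t with hg₁d
  set g₂ : ℝ → ℂ := fun t => h₂ t + Complex.I * l₀ * y₂ t - q₂ t * y₁ t with hg₂d
  have iy₁ : IntegrableOn y₁ (Icc 0 Real.pi) := hy₁.continuousOn.integrableOn_Icc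
  have iy₂ : IntegrableOn y₂ (Icc 0 Real.pi) := hy₂.continuousOn.integrableOn_Icc
  have hg₁ : IntegrableOn g₁ (Icc 0 Real.pi) :=
    (hy₁.integrableOn.sub (iy₁.const_mul _)).sub
      (hq₁.mul_continuousOn hy₂.continuousOn isCompact_Icc)
  have hg₂ : IntegrableOn g₂ (Icc 0 Real.pi) :=
    (hy₂.integrableOn.add (iy₂.const_mul _)).sub
      (hq₂.mul_continuousOn hy₁.continuousOn isCompact_Icc)
  have hys : IsSol q₁ q₂ g₁ g₂ l₀ y₁ y₂ :=
    ⟨hy₁.congr fun t => by rw [hg₁d]; ring, hy₂.congr fun t => by rw [hg₂d]; ring⟩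
  set G := sourcePair hg₁ hg₂ with hG
  obtain ⟨N, hN, hNG⟩ := exists_pencil_solution hq₁ hq₂ U G
  set Φ : Pair × (ℂ × ℂ) →L[ℂ] ℂ :=
    φ.comp ((pairToLp α).comp (ContinuousLinearMap.fst ℂ _ _))
  have hΦ : ∀ w, Φ w = φ (pairToLp α w.1) := fun w => rfl
  obtain ⟨F, hF, hFN⟩ := exists_entire_quotient (pencilA hq₁ hq₂ U) pencilS Φ (rootPairs p₂ p₃ U)
    (fun l => Or.inl (by simp)) (fun l v hv z h => rootPairs_chain hq₁ hq₂ hv h)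
    (by
      intro l w hw
      rw [hΦ]
      rcases hw with hw | hw
      · have h0 : pairToLp α w.1 = 0 := by
          funext j
          refine Lp.ext ?_
          have h1 := coeFn_pairToH w.1 j
          rw [hw] at h1
          filter_upwards [coeFn_pairToLp α w.1 j, h1, Lp.coeFn_zero ℂ 2 segMeasure,
            Lp.coeFn_zero ℂ α segMeasure] with x e1 e2 e3 e4
          have e5 : ((0 : H) j : ℝ → ℂ) x = 0 := e3
          have e6 : ((0 : LpPair α) j : ℝ → ℂ) x = 0 := e4
          rw [e1, ← e2, e5, e6]
        rw [h0, map_zero]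
      · exact hφ l _ hw _ fun j => (coeFn_pairToLp α w.1 j).trans (coeFn_pairToH w.1 j).symm)
    (fun l => hN.analyticAt l) (differentiable_charDet hq₁ hq₂ U) ⟨l₀, hD l₀ hl₀ hg₀⟩ (G, 0) hNG
  have hsol : ∀ l, charDet hq₁ hq₂ U l ≠ 0 → ∃ z : Pair, IsSol q₁ q₂ g₁ g₂ l z.1 z.2 ∧
      BCond U z.1 z.2 ∧ φ (pairToLp α z) = F l := by
    intro l hl
    have h1 : pencilA hq₁ hq₂ U ((charDet hq₁ hq₂ U l)⁻¹ • N l) -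
        l • pencilS ((charDet hq₁ hq₂ U l)⁻¹ • N l) = (G, 0) := by
      rw [map_smul, map_smul, smul_comm, ← smul_sub, hNG, smul_smul, inv_mul_cancel₀ hl, one_smul]
    rw [pencil_eq_iff] at h1
    refine ⟨((charDet hq₁ hq₂ U l)⁻¹ • N l).1, (isSol_of_eq hq₁ hq₂ hg₁ hg₂ (fun x => ?_)
      (fun x => ?_) h1.1).1, bcond_of_bform h1.2, ?_⟩
    · simp [hG, sourcePair, volterra_apply]
    · simp [hG, sourcePair, volterra_apply]
    · have h2 := hFN l
      rw [← hΦ, map_smul, h2, smul_eq_mul, ← mul_assoc, inv_mul_cancel₀ hl, one_mul]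
  obtain ⟨C, hC, hCb⟩ := exists_norm_pairToLp_le α
  have hF0 : ∀ l, F l = 0 := by
    refine eq_zero_of_small_on_rectangles hF x₀ M fun ε hε => ?_
    have hε' : 0 < ε / ((‖φ‖ + 1) * C) := by positivity
    obtain ⟨R, hR⟩ := hap q₁ q₂ g₁ g₂ hq₁ hq₂ hg₁ hg₂ _ hε'
    refine ⟨max R R₀, fun l hl hgood => ?_⟩
    obtain ⟨z, hzs, hzb, hzF⟩ := hsol l (hD l ((le_max_right _ _).trans hl) hgood)
    rw [← hzF]
    have h1 := hCb z _ hε'.le (hR l ((le_max_left _ _).trans hl) hgood _ _ hzs hzb)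
    calc ‖φ (pairToLp α z)‖ ≤ ‖φ‖ * ‖pairToLp α z‖ := φ.le_opNorm _
      _ ≤ (‖φ‖ + 1) * (C * (ε / ((‖φ‖ + 1) * C))) := by gcongr; linarith
      _ = ε := by field_simp
  -- `F l₀ = 0` says that `φ` vanishes at the solution for `l₀`, which is the given pair by
  -- uniqueness.
  obtain ⟨z, hzs, hzb, hzF⟩ := hsol l₀ (hD l₀ hl₀ hg₀)
  rw [hF0] at hzF
  rw [← hzF]
  congr 1
  have hd := hys.sub hzs
  simp only [sub_self] at hd
  have hd0 := huniq l₀ hl₀ hg₀ _ _ hd fun i => by linear_combination hbc i - hzb i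
  funext j
  refine Lp.ext ?_
  filter_upwards [hv j, coeFn_pairToLp α z j, ae_segMeasure_of_forall hd0] with x e1 e2 e3
  rw [e1, e2, sub_eq_zero.1 e3.1, sub_eq_zero.1 e3.2]

/-! ### Density of functions vanishing at the endpoints -/

theorem memLp_of_continuousOn {f : ℝ → ℂ} (hf : ContinuousOn f (Icc 0 Real.pi)) (α : ℝ≥0∞) :
    MemLp f α segMeasure := by
  obtain ⟨C, hC⟩ := isCompact_Icc.exists_bound_of_continuousOn hf
  exact MemLp.of_bound (hf.aestronglyMeasurable measurableSet_Icc) C (ae_segMeasure_of_forall hC)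

/-- Dominated convergence with majorant `1`. The powers serve as endpoint corrections of vanishing
`L_α` norm, which is possible only for `α < ∞`. -/
theorem tendsto_eLpNorm_pow {r : ℝ → ℂ} (hc : Continuous r) (h₁ : ∀ x ∈ Icc 0 Real.pi, ‖r x‖ ≤ 1)
    (h₂ : ∀ x ∈ Ioo 0 Real.pi, ‖r x‖ < 1) {α : ℝ≥0∞} (h0 : α ≠ 0) (hα : α ≠ ∞) :
    Tendsto (fun n : ℕ => eLpNorm (r ^ n) α segMeasure) atTop (𝓝 0) := by
  have hα' : 0 < α.toReal := ENNReal.toReal_pos h0 hα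
  simp only [eLpNorm_eq_lintegral_rpow_enorm_toReal h0 hα, Pi.pow_apply]
  have h3 : Tendsto (fun n : ℕ => ∫⁻ x, ‖r x ^ n‖ₑ ^ α.toReal ∂segMeasure) atTop
      (𝓝 (∫⁻ _, 0 ∂segMeasure)) := by
    refine tendsto_lintegral_of_dominated_convergence (fun _ => 1) (fun n => ?_) (fun n => ?_) ?_ ?_
    · exact ((hc.pow n).measurable.enorm).pow_const _
    · refine ae_segMeasure_of_forall fun x hx => ?_
      refine ENNReal.rpow_le_one ?_ hα'.le
      rw [enorm_pow]
      refine pow_le_one₀ zero_le ?_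
      rw [← ofReal_norm, ENNReal.ofReal_le_one]
      exact h₁ x hx
    · simp
    · refine (ae_restrict_iff' measurableSet_Icc).2 (IsPrimitive.ae_Ioo _
        (Eventually.of_forall fun x hx => ?_))
      have h4 : Tendsto (fun n : ℕ => ‖r x ^ n‖ₑ) atTop (𝓝 0) := by
        have := (tendsto_pow_atTop_nhds_zero_of_norm_lt_one (h₂ x hx)).enorm
        simpa using this
      have := (ENNReal.continuous_rpow_const (y := α.toReal)).continuousAt.tendsto.comp h4
      rw [ENNReal.zero_rpow_of_pos hα'] at this
      exact this
  rw [lintegral_zero] at h3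
  have := (ENNReal.continuous_rpow_const (y := 1 / α.toReal)).continuousAt.tendsto.comp h3
  rw [ENNReal.zero_rpow_of_pos (by positivity)] at this
  exact this

theorem tendsto_apply_single_pow {r : ℝ → ℂ} (hc : Continuous r)
    (h₁ : ∀ x ∈ Icc 0 Real.pi, ‖r x‖ ≤ 1) (h₂ : ∀ x ∈ Ioo 0 Real.pi, ‖r x‖ < 1)
    {α : ℝ≥0∞} [hα₁ : Fact (1 ≤ α)] (hα : α ≠ ∞) (ψ : Lp ℂ α segMeasure →L[ℂ] ℂ) :
    Tendsto (fun n : ℕ => ψ ((memLp_of_continuousOn (hc.pow n).continuousOn α).toLp)) atTop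
      (𝓝 0) := by
  have h0 : α ≠ 0 := (zero_lt_one.trans_le hα₁.out).ne'
  have h3 := (ENNReal.tendsto_toReal ENNReal.zero_ne_top).comp (tendsto_eLpNorm_pow hc h₁ h₂ h0 hα)
  have h4 : Tendsto (fun n : ℕ => (memLp_of_continuousOn (hc.pow n).continuousOn α).toLp) atTop
      (𝓝 (0 : Lp ℂ α segMeasure)) := by
    rw [tendsto_zero_iff_norm_tendsto_zero]
    simpa [Lp.norm_toLp, Function.comp_def] using h3
  have h5 := (ψ.continuous.tendsto 0).comp h4
  rwa [map_zero] at h5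

/-- A functional on `L_α[0,π]`, `α < ∞`, which vanishes on the `C¹` functions that vanish at both
endpoints is zero. -/
theorem dual_eq_zero_of_endpoints {α : ℝ≥0∞} [hα₁ : Fact (1 ≤ α)] (hα : α ≠ ∞)
    (ψ : Lp ℂ α segMeasure →L[ℂ] ℂ)
    (h : ∀ g : ℝ → ℂ, ContDiff ℝ 1 g → g 0 = 0 → g Real.pi = 0 → ∀ v : Lp ℂ α segMeasure,
      (v : ℝ → ℂ) =ᵐ[segMeasure] g → ψ v = 0) : ψ = 0 := by
  set r : ℝ → ℂ := fun x => ((1 - x / Real.pi : ℝ) : ℂ) with hr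
  set s : ℝ → ℂ := fun x => ((x / Real.pi : ℝ) : ℂ) with hs
  have hrd : ContDiff ℝ 1 r := Complex.ofRealCLM.contDiff.comp
    (contDiff_const.sub (contDiff_id.div_const _))
  have hsd : ContDiff ℝ 1 s := Complex.ofRealCLM.contDiff.comp (contDiff_id.div_const _)
  have hrc : Continuous r := hrd.continuous
  have hsc : Continuous s := hsd.continuous
  have hrt := tendsto_apply_single_pow hrc
    (fun x hx => by
      have h1 : 0 ≤ x / Real.pi := div_nonneg hx.1 Real.pi_pos.le
      have h2 : x / Real.pi ≤ 1 := div_le_one_of_le₀ hx.2 Real.pi_pos.le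
      rw [hr, Complex.norm_real, Real.norm_of_nonneg (by linarith)]
      linarith)
    (fun x hx => by
      have h1 : 0 < x / Real.pi := div_pos hx.1 Real.pi_pos
      have h2 : x / Real.pi < 1 := (div_lt_one Real.pi_pos).2 hx.2
      rw [hr, Complex.norm_real, Real.norm_of_nonneg (by linarith)]
      linarith) hα ψ
  have hst := tendsto_apply_single_pow hsc
    (fun x hx => by
      have h1 : 0 ≤ x / Real.pi := div_nonneg hx.1 Real.pi_pos.le
      rw [hs, Complex.norm_real, Real.norm_of_nonneg h1]
      exact div_le_one_of_le₀ hx.2 Real.pi_pos.le)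
    (fun x hx => by
      have h1 : 0 < x / Real.pi := div_pos hx.1 Real.pi_pos
      rw [hs, Complex.norm_real, Real.norm_of_nonneg h1.le]
      exact (div_lt_one Real.pi_pos).2 hx.2) hα ψ
  have hclosed : IsClosed {v | ψ v = 0} := isClosed_eq ψ.continuous continuous_const
  refine ContinuousLinearMap.ext fun v => ?_
  have hdense := Lp.dense_hasCompactSupport_contDiff (F := ℂ) (μ := segMeasure) hα
  refine hclosed.closure_subset_iff.2 ?_ (hdense v)
  rintro f ⟨g, hfg, -, hg⟩
  have hg1 : ContDiff ℝ 1 g := hg.of_le (by exact_mod_cast le_top)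
  set R : ℕ → Lp ℂ α segMeasure := fun n => (memLp_of_continuousOn (hrc.pow n).continuousOn α).toLp
  set T : ℕ → Lp ℂ α segMeasure := fun n => (memLp_of_continuousOn (hsc.pow n).continuousOn α).toLp
  have hr0 : r 0 = 1 := by simp [hr]
  have hrpi : r Real.pi = 0 := by simp [hr, Real.pi_ne_zero]
  have hs0 : s 0 = 0 := by simp [hs]
  have hspi : s Real.pi = 1 := by simp [hs, Real.pi_ne_zero]
  -- Subtracting these multiples of `r ^ (n + 1)` and `s ^ (n + 1)` makes `g` vanish at both
  -- endpoints. The exponent must be positive so that each power vanishes at the endpoint it should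
  -- not affect.
  have hn : ∀ n : ℕ, ψ f = g 0 * ψ (R (n + 1)) + g Real.pi * ψ (T (n + 1)) := by
    intro n
    have h1 := h (fun x => g x - g 0 * r x ^ (n + 1) - g Real.pi * s x ^ (n + 1))
      ((hg1.sub (contDiff_const.mul (hrd.pow _))).sub (contDiff_const.mul (hsd.pow _)))
      (by simp [hr0, hs0]) (by simp [hrpi, hspi])
      (f - g 0 • R (n + 1) - g Real.pi • T (n + 1)) (by
        filter_upwards [hfg, Lp.coeFn_sub (f - g 0 • R (n + 1)) (g Real.pi • T (n + 1)),
          Lp.coeFn_sub f (g 0 • R (n + 1)), Lp.coeFn_smul (g 0) (R (n + 1)),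
          Lp.coeFn_smul (g Real.pi) (T (n + 1)),
          (memLp_of_continuousOn (hrc.pow (n + 1)).continuousOn α).coeFn_toLp,
          (memLp_of_continuousOn (hsc.pow (n + 1)).continuousOn α).coeFn_toLp]
          with x e1 e2 e3 e4 e5 e6 e7
        rw [e2, Pi.sub_apply, e3, Pi.sub_apply, e4, e5, Pi.smul_apply, Pi.smul_apply, e1, e6, e7]
        rfl)
    rw [map_sub, map_sub, map_smul, map_smul, smul_eq_mul, smul_eq_mul] at h1
    linear_combination h1
  have hlim : Tendsto (fun n : ℕ => g 0 * ψ (R (n + 1)) + g Real.pi * ψ (T (n + 1))) atTop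
      (𝓝 (g 0 * 0 + g Real.pi * 0)) :=
    ((hrt.comp (tendsto_add_atTop_nat 1)).const_mul _).add
      ((hst.comp (tendsto_add_atTop_nat 1)).const_mul _)
  simp only [← hn, mul_zero, add_zero] at hlim
  exact tendsto_nhds_unique tendsto_const_nhds hlim

theorem isPrimitive_of_contDiff {g : ℝ → ℂ} (hg : ContDiff ℝ 1 g) : IsPrimitive g (deriv g) :=
  IsPrimitive.of_hasDerivAt (fun x => (hg.differentiable one_ne_zero x).hasDerivAt)
    (hg.continuous_deriv le_rfl)

theorem dual_eq_zero_of_root {p₂ p₃ : ℝ → ℂ} (hp₂ : IntegrableOn p₂ (Icc 0 Real.pi))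
    (hp₃ : IntegrableOn p₃ (Icc 0 Real.pi)) {U : Matrix (Fin 2) (Fin 4) ℂ} (hU : IsRegularBC U)
    {α : ℝ≥0∞} [Fact (1 ≤ α)] (hα : α ≠ ∞) (φ : LpPair α →L[ℂ] ℂ)
    (hφ : ∀ z u, IsRootFunction (diracOperator (offDiag p₂ p₃) U) z u → ∀ v : LpPair α,
      (∀ j, (v j : ℝ → ℂ) =ᵐ[segMeasure] (u j : ℝ → ℂ)) → φ v = 0) : φ = 0 := by
  have hz : IsPrimitive (fun _ => 0) (deriv fun _ : ℝ => (0 : ℂ)) :=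
    isPrimitive_of_contDiff contDiff_const
  have hs : ∀ j, φ.comp (ContinuousLinearMap.single ℂ (fun _ => Lp ℂ α segMeasure) j) = 0 := by
    intro j
    refine dual_eq_zero_of_endpoints hα _ fun g hg g0 gpi v hv => ?_
    have hgp := isPrimitive_of_contDiff hg
    have h0 : ((0 : Lp ℂ α segMeasure) : ℝ → ℂ) =ᵐ[segMeasure] fun _ => 0 :=
      Lp.coeFn_zero ℂ α segMeasure
    change φ (Pi.single j v) = 0
    fin_cases j
    · refine dual_eq_zero_of_bcond hp₂ hp₃ hU φ hφ hgp hz (fun i => by simp [g0, gpi]) _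
        (Fin.forall_fin_two.2 ⟨?_, ?_⟩)
      · simpa using hv
      · simpa using h0
    · refine dual_eq_zero_of_bcond hp₂ hp₃ hU φ hφ hz hgp (fun i => by simp [g0, gpi]) _
        (Fin.forall_fin_two.2 ⟨?_, ?_⟩)
      · simpa using h0
      · simpa using hv
  refine ContinuousLinearMap.ext fun v => ?_
  have e : v = Pi.single 0 (v 0) + Pi.single 1 (v 1) := by
    funext j
    fin_cases j <;> simp
  have h0 : φ (Pi.single 0 (v 0)) = 0 := congrArg (fun T => T (v 0)) (hs 0)
  have h1 : φ (Pi.single 1 (v 1)) = 0 := congrArg (fun T => T (v 1)) (hs 1)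
  rw [e, map_add, h0, h1, add_zero]
  rfl

/-! ### Duality and the completeness of root systems -/

/-- Hahn–Banach in the quotient by the closure: a norming functional of a nonzero class pulls back
to a nonzero functional that vanishes on `S`. -/
theorem topologicalClosure_eq_top_of_dual {E : Type*} [NormedAddCommGroup E] [NormedSpace ℂ E]
    (S : Submodule ℂ E) (h : ∀ φ : E →L[ℂ] ℂ, (∀ v ∈ S, φ v = 0) → φ = 0) :
    S.topologicalClosure = ⊤ := by
  rw [Submodule.eq_top_iff']
  intro x
  have hcl : IsClosed (S.topologicalClosure : Set E) := S.isClosed_topologicalClosure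
  rw [← Submodule.Quotient.mk_eq_zero]
  by_contra hx
  obtain ⟨g, -, hg⟩ := exists_dual_vector ℂ (Submodule.Quotient.mk x : E ⧸ S.topologicalClosure)
    (norm_ne_zero_iff.2 hx)
  have h1 := h (g.comp S.topologicalClosure.mkQL) fun v hv => by
    have : S.topologicalClosure.mkQL v = 0 :=
      (Submodule.Quotient.mk_eq_zero _).2 (S.le_topologicalClosure hv)
    rw [ContinuousLinearMap.comp_apply, this, map_zero]
  have h2 : g (Submodule.Quotient.mk x) = 0 := congrArg (fun T : E →L[ℂ] ℂ => T x) h1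
  rw [h2] at hg
  exact hx (norm_eq_zero.1 (Complex.ofReal_eq_zero.1 hg.symm))

theorem memLp_of_isRootFunction {P : ℝ → Matrix (Fin 2) (Fin 2) ℂ}
    {U : Matrix (Fin 2) (Fin 4) ℂ} {z : ℂ} {u : H} (hu : IsRootFunction (diracOperator P U) z u)
    (α : ℝ≥0∞) (j : Fin 2) : MemLp (u j : ℝ → ℂ) α segMeasure := by
  have hd : ∃ w : (diracOperator P U).domain, (w : H) = u := by
    cases hu with
    | eigen w _ _ => exact ⟨w, rfl⟩
    | assoc w _ _ _ => exact ⟨w, rfl⟩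
  obtain ⟨w, rfl⟩ := hd
  have h1 := LinearPMap.mem_graph _ w
  rw [diracOperator_graph] at h1
  obtain ⟨y, hy⟩ := h1
  have h2 := hy.ac.continuousOn
  rw [uIcc_of_le Real.pi_pos.le] at h2
  exact (memLp_congr_ae (hy.rep j)).2 (memLp_of_continuousOn (continuousOn_pi.1 h2 j) α)

/-- Root systems span in `H`, whereas completeness concerns spans in `LpPair α`; finite combinations
transfer through almost everywhere equality. -/
theorem exists_rep_mem_span {α : ℝ≥0∞} [Fact (1 ≤ α)] {S : Set H}
    (hS : ∀ u ∈ S, ∀ j, MemLp (u j : ℝ → ℂ) α segMeasure) {u : H} (hu : u ∈ Submodule.span ℂ S) :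
    ∃ v ∈ Submodule.span ℂ {v : LpPair α | ∃ u ∈ S, ∀ j,
      (v j : ℝ → ℂ) =ᵐ[segMeasure] (u j : ℝ → ℂ)},
      ∀ j, (v j : ℝ → ℂ) =ᵐ[segMeasure] (u j : ℝ → ℂ) := by
  induction hu using Submodule.span_induction with
  | mem u hu =>
    have h1 : ∀ j, ((hS u hu j).toLp : ℝ → ℂ) =ᵐ[segMeasure] (u j : ℝ → ℂ) := fun j =>
      (hS u hu j).coeFn_toLp
    exact ⟨fun j => (hS u hu j).toLp, Submodule.subset_span ⟨u, hu, h1⟩, h1⟩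
  | zero =>
    exact ⟨0, Submodule.zero_mem _, fun j =>
      (Lp.coeFn_zero ℂ α segMeasure).trans (Lp.coeFn_zero ℂ 2 segMeasure).symm⟩
  | add x y _ _ hx hy =>
    obtain ⟨v, hv, hv'⟩ := hx
    obtain ⟨w, hw, hw'⟩ := hy
    refine ⟨v + w, Submodule.add_mem _ hv hw, fun j => ?_⟩
    exact (Lp.coeFn_add (v j) (w j)).trans
      (((hv' j).add (hw' j)).trans (Lp.coeFn_add (x j) (y j)).symm)
  | smul c x _ hx =>
    obtain ⟨v, hv, hv'⟩ := hx
    refine ⟨c • v, Submodule.smul_mem _ c hv, fun j => ?_⟩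
    exact (Lp.coeFn_smul c (v j)).trans
      (((hv' j).const_smul c).trans (Lp.coeFn_smul c (x j)).symm)

end DiracOp

end

theorem mainTheorem3 (p₂ p₃ : ℝ → ℂ)
    (hp₂ : IntegrableOn p₂ (Set.Icc 0 Real.pi)) (hp₃ : IntegrableOn p₃ (Set.Icc 0 Real.pi))
    (U : Matrix (Fin 2) (Fin 4) ℂ) (hU : DiracOp.IsRegularBC U)
    (α : ℝ≥0∞) [Fact (1 ≤ α)] (hα : α ≠ ∞) :
    DiracOp.IsCompleteIn α
      {u | ∃ z, DiracOp.IsRootFunction (DiracOp.diracOperator (DiracOp.offDiag p₂ p₃) U) z u} ∧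
    ∀ (ev : ℤ → ℂ) (y : ℤ → DiracOp.H),
      DiracOp.IsRootSystem (DiracOp.diracOperator (DiracOp.offDiag p₂ p₃) U) ev y →
        DiracOp.IsCompleteIn α (Set.range y) := by
  have hfirst : DiracOp.IsCompleteIn α
      {u | ∃ z, DiracOp.IsRootFunction (DiracOp.diracOperator (DiracOp.offDiag p₂ p₃) U) z u} := by
    refine ⟨fun u ⟨z, hu⟩ j => DiracOp.memLp_of_isRootFunction hu α j, ?_⟩
    refine DiracOp.topologicalClosure_eq_top_of_dual _ fun φ hφ => ?_
    exact DiracOp.dual_eq_zero_of_root hp₂ hp₃ hU hα φ fun z u hu v hv =>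
      hφ v (Submodule.subset_span ⟨u, ⟨z, hu⟩, hv⟩)
  refine ⟨hfirst, fun ev y hy => ?_⟩
  have hmem : ∀ u ∈ Set.range y, ∀ j, MemLp (u j : ℝ → ℂ) α DiracOp.segMeasure := by
    rintro _ ⟨n, rfl⟩ j
    exact DiracOp.memLp_of_isRootFunction (hy.root n) α j
  refine ⟨hmem, top_le_iff.1 (hfirst.2.symm.le.trans (Submodule.topologicalClosure_mono ?_))⟩
  -- Each root function is a finite combination of the members of the system, so the span already
  -- shown to be dense lies in the span of the system.
  refine Submodule.span_le.2 ?_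
  rintro v ⟨u, ⟨z, hu⟩, hv⟩
  obtain ⟨w, hw, hw'⟩ := DiracOp.exists_rep_mem_span hmem
    (Submodule.span_mono (Set.image_subset_range _ _) (hy.span z u hu))
  have hvw : v = w := funext fun j => Lp.ext ((hv j).trans (hw' j).symm)
  rw [hvw]
  exact hw
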